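/- All spaces are over a fixed scalar field $\mathbb F\in\{\mathbb R,\mathbb C\}$. A \emph{quasi-Banach space} is a vector space with a quasi-norm (a map $\|\cdot\|\ge 0$ that vanishes only at $0$, is absolutely homogeneous, and satisfies $\|f+g\|\le\kappa(\|f\|+\|g\|)$ for some constant $\kappa\ge 1$) whose induced vector topology is complete. $\simeq$ denotes linear homeomorphism, and $X\oplus Y$ is the Cartesian product with the quasi-norm $\max\{\|x\|,\|y\|\}$. The \emph{Banach envelope} of a quasi-Banach space $X$ is the Banach space $\widehat X$ together with a linear contraction $J_X\colon X\to\widehat X$ such that every linear contraction $T$ from $X$ into a Banach space factors uniquely as $T=\widehat T\circ J_X$ with $\widehat T$ a linear contraction. A subspace is \emph{complemented} if it is the range of a bounded linear projection. A countable family $(b_n)_{n\in N}$ is an \emph{unconditional basis} of $X$ if its closed linear span is $X$ and every $f\in X$ has a unique unconditionally convergent expansion $f=\sum_{n\in N}a_nb_n$; $[b_n\colon n\in A]$ denotes the closed linear span of $(b_n)_{n\in A}$. Let $X,Y$ be quasi-Banach spaces. \begin{itemize} \item $(X,Y)$ is \emph{splitting for unconditional bases} if for every unconditional basis $(b_n)_{n\in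 N}$ of $X\oplus Y$ there is $A\subseteq N$ with $[b_n\colon n\in A]\simeq X$ and $[b_n\colon n\in N\setminus A]\simeq Y$. \item $(X,Y)$ is \emph{splitting for complemented subspaces} if for every complemented subspace $V$ of $X\oplus Y$ there are complemented subspaces $V_1$ of $X$ and $V_2$ of $Y$ and an automorphism $T$ of $X\oplus Y$ with $T(V)=V_1\oplus V_2$. \item $X$ and $Y$ are \emph{complementably incomparable} if no infinite-dimensional quasi-Banach space is isomorphic both to a complemented subspace of $X$ and to a complemented subspace of $Y$. \item A quasi-Banach lattice $L$ is \emph{$L$-convex} if there is $\varepsilon>0$ such that whenever $k\ge1$, $0\le f_i\le f$ for $1\le i\le k$ and $\sum_{i=1}^kf_i\ge(1-\varepsilon)kf$, then $\max_i\|f_i\|\ge\varepsilon\|f\|$. A quasi-Banach space is \emph{natural} if it is isomorphic to a subspace of an $L$-convex quasi-Banach lattice. \item A Banach space $U$ is a \emph{proper envelope} (resp. a \emph{proper envelope of a natural space}) if there is a quasi-Banach space (resp. a natural quasi-Banach space) $Z$ that is not locally convex, whose dual $Z^*$ separates the points of $Z$, and whose Banach envelope satisfies $\widehat Z\simeq U$.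 \end{itemize} \textbf{Lemma.} Let $X$ be a quasi-Banach space and $U$ a Banach space. Suppose that \begin{enumerate} \item[(i)] $(X,U)$ is splitting for complemented subspaces; \item[(ii)] $(\widehat X,U)$ is splitting for unconditional bases; \item[(iii)] $\widehat X$ and $U$ are complementably incomparable; and \item[(iv)] either $U$ is not a proper envelope, or $X$ is natural and $U$ is not a proper envelope of a natural space. \end{enumerate} Then $(X,U)$ is splitting for unconditional bases. -/

import Mathlib

open Filter Topology

universe u v w

/-- A quasi-Banach space over `𝕜 = ℝ` or `ℂ`: a topological vector space whose topology is given by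
a complete quasi-norm. -/
class QuasiBanachSpace (𝕜 : Type*) (X : Type*) [RCLike 𝕜] [AddCommGroup X] [Module 𝕜 X]
    [TopologicalSpace X] [IsTopologicalAddGroup X] [ContinuousSMul 𝕜 X] where
  /-- The quasi-norm. -/
  qnorm : X → ℝ
  qnorm_nonneg : ∀ x, 0 ≤ qnorm x
  qnorm_eq_zero : ∀ x, qnorm x = 0 ↔ x = 0
  qnorm_smul : ∀ (a : 𝕜) (x : X), qnorm (a • x) = ‖a‖ * qnorm x
  exists_modulus : ∃ κ : ℝ, 1 ≤ κ ∧ ∀ x y, qnorm (x + y) ≤ κ * (qnorm x + qnorm y)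
  nhds_zero_basis : (𝓝 (0 : X)).HasBasis (fun ε : ℝ => 0 < ε) (fun ε => {x | qnorm x < ε})
  complete : ∀ s : ℕ → X,
    (∀ ε : ℝ, 0 < ε → ∃ N, ∀ m, N ≤ m → ∀ n, N ≤ n → qnorm (s m - s n) < ε) →
      ∃ x, Tendsto s atTop (𝓝 x)

/-! ### The Banach envelope -/

noncomputable section Envelope

variable (𝕜 : Type*) (X : Type*) [RCLike 𝕜] [AddCommGroup X] [Module 𝕜 X]
  [TopologicalSpace X] [IsTopologicalAddGroup X] [ContinuousSMul 𝕜 X] [QuasiBanachSpace 𝕜 X]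

/-- The largest seminorm dominated by the quasi-norm (that is, the Minkowski functional of the
convex hull of the unit ball). -/
def envelopeSeminorm : Seminorm 𝕜 X :=
  sSup {p : Seminorm 𝕜 X | ∀ x, p x ≤ QuasiBanachSpace.qnorm 𝕜 x}

/-- The vector space `X`, regarded as a seminormed space with the envelope seminorm. -/
@[nolint unusedArguments]
def PreEnvelope (_𝕜 : Type*) (X : Type*) : Type _ := X

instance : AddCommGroup (PreEnvelope 𝕜 X) := inferInstanceAs (AddCommGroup X)

instance : Module 𝕜 (PreEnvelope 𝕜 X) := inferInstanceAs (Module 𝕜 X)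

instance : SeminormedAddCommGroup (PreEnvelope 𝕜 X) :=
  AddGroupSeminorm.toSeminormedAddCommGroup (E := PreEnvelope 𝕜 X)
    (envelopeSeminorm 𝕜 X).toAddGroupSeminorm

instance : NormedSpace 𝕜 (PreEnvelope 𝕜 X) where
  norm_smul_le a x := (map_smul_eq_mul (envelopeSeminorm 𝕜 X) a x).le

/-- The Banach envelope: the (Hausdorff) completion of `X` under the envelope seminorm. -/
abbrev BanachEnvelope : Type _ := UniformSpace.Completion (PreEnvelope 𝕜 X)

/-- The envelope map `J : X → X̂`. -/
def envelopeMap : X →ₗ[𝕜] BanachEnvelope 𝕜 X :=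
  (UniformSpace.Completion.toComplₗᵢ (𝕜 := 𝕜) (E := PreEnvelope 𝕜 X)).toLinearMap

variable {𝕜 X}

theorem envelopeSeminorm_bddAbove :
    BddAbove {p : Seminorm 𝕜 X | ∀ x, p x ≤ QuasiBanachSpace.qnorm 𝕜 x} := by
  rw [Seminorm.bddAbove_iff]
  refine ⟨QuasiBanachSpace.qnorm 𝕜, ?_⟩
  rintro _ ⟨p, hp, rfl⟩ x
  exact hp x

theorem norm_envelopeMap (x : X) : ‖envelopeMap 𝕜 X x‖ = envelopeSeminorm 𝕜 X x :=
  (UniformSpace.Completion.toComplₗᵢ (𝕜 := 𝕜) (E := PreEnvelope 𝕜 X)).norm_map x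

/-- The envelope map is a contraction. -/
theorem norm_envelopeMap_le (x : X) : ‖envelopeMap 𝕜 X x‖ ≤ QuasiBanachSpace.qnorm 𝕜 x := by
  rw [norm_envelopeMap, envelopeSeminorm, Seminorm.sSup_apply envelopeSeminorm_bddAbove]
  exact Real.iSup_le (fun p => p.2 x) (QuasiBanachSpace.qnorm_nonneg x)

/-- The universal property of the Banach envelope. -/
theorem existsUnique_envelope_lift {Y : Type*} [NormedAddCommGroup Y] [NormedSpace 𝕜 Y]
    [CompleteSpace Y] (T : X →ₗ[𝕜] Y) (hT : ∀ x, ‖T x‖ ≤ QuasiBanachSpace.qnorm 𝕜 x) :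
    ∃! S : BanachEnvelope 𝕜 X →ₗ[𝕜] Y,
      (∀ z, ‖S z‖ ≤ ‖z‖) ∧ ∀ x, S (envelopeMap 𝕜 X x) = T x := by
  have hle : ∀ x, ‖T x‖ ≤ envelopeSeminorm 𝕜 X x := fun x =>
    le_csSup envelopeSeminorm_bddAbove
      (show (normSeminorm 𝕜 Y).comp T ∈ _ from hT) x
  let T' : PreEnvelope 𝕜 X →L[𝕜] Y :=
    LinearMap.mkContinuous (show PreEnvelope 𝕜 X →ₗ[𝕜] Y from T) 1
      (fun x => (hle x).trans_eq (one_mul _).symm)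
  let J : PreEnvelope 𝕜 X →L[𝕜] BanachEnvelope 𝕜 X := UniformSpace.Completion.toComplL
  have hd : DenseRange J := UniformSpace.Completion.denseRange_coe
  have hJ : IsUniformInducing J := UniformSpace.Completion.isUniformInducing_coe _
  have hext : ∀ x, T'.extend J (J x) = T' x := fun x => T'.extend_eq hd hJ x
  refine ⟨(T'.extend J).toLinearMap, ⟨fun z => ?_, fun x => hext x⟩, ?_⟩
  · refine hd.induction_on (p := fun z => ‖T'.extend J z‖ ≤ ‖z‖) z
      (isClosed_le (T'.extend J).continuous.norm continuous_norm) fun x => ?_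
    rw [hext]
    exact (hle x).trans_eq (norm_envelopeMap (X := X) x).symm
  · rintro S ⟨hS, hSJ⟩
    have hc : Continuous S :=
      AddMonoidHomClass.continuous_of_bound S 1 fun z => by simpa using hS z
    refine LinearMap.ext fun z => congrFun (hd.equalizer hc (T'.extend J).continuous ?_) z
    funext x
    exact (hSJ x).trans (hext x).symm

end Envelope

/-! ### Bases, splitting and incomparability -/

section Splitting

/-- The closed linear span `[b n : n ∈ A]`. -/
abbrev closedSpan (𝕜 : Type*) {X ι : Type*} [RCLike 𝕜] [AddCommGroup X] [Module 𝕜 X]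
    [TopologicalSpace X] [IsTopologicalAddGroup X] [ContinuousSMul 𝕜 X]
    (b : ι → X) (A : Set ι) : Submodule 𝕜 X :=
  (Submodule.span 𝕜 (b '' A)).topologicalClosure

/-- A countable family `b` is an unconditional basis of `X` if its closed linear span is `X` and
every vector has a unique unconditionally convergent expansion `∑ a n • b n`. -/
structure IsUnconditionalBasis (𝕜 : Type*) {X ι : Type*} [RCLike 𝕜] [AddCommGroup X] [Module 𝕜 X]
    [TopologicalSpace X] [IsTopologicalAddGroup X] [ContinuousSMul 𝕜 X] (b : ι → X) : Prop where
  countable : Countable ι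
  closedSpan_eq_top : closedSpan 𝕜 b Set.univ = ⊤
  existsUnique_hasSum : ∀ f : X, ∃! a : ι → 𝕜, HasSum (fun n => a n • b n) f

variable (𝕜 : Type*) (X Y : Type*) [RCLike 𝕜]
  [AddCommGroup X] [Module 𝕜 X] [TopologicalSpace X] [IsTopologicalAddGroup X] [ContinuousSMul 𝕜 X]
  [AddCommGroup Y] [Module 𝕜 Y] [TopologicalSpace Y] [IsTopologicalAddGroup Y] [ContinuousSMul 𝕜 Y]

/-- The pair `(X, Y)` is splitting for unconditional bases. (Every countable index set is in
bijection with one in `Type`.) -/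
def SplittingForUnconditionalBases : Prop :=
  ∀ (ι : Type) (b : ι → X × Y), IsUnconditionalBasis 𝕜 b →
    ∃ A : Set ι, Nonempty (closedSpan 𝕜 b A ≃L[𝕜] X) ∧ Nonempty (closedSpan 𝕜 b Aᶜ ≃L[𝕜] Y)

/-- The pair `(X, Y)` is splitting for complemented subspaces. -/
def SplittingForComplementedSubspaces : Prop :=
  ∀ V : Submodule 𝕜 (X × Y), V.ClosedComplemented →
    ∃ (V₁ : Submodule 𝕜 X) (V₂ : Submodule 𝕜 Y) (T : (X × Y) ≃L[𝕜] (X × Y)),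
      V₁.ClosedComplemented ∧ V₂.ClosedComplemented ∧
        V.map (T : (X × Y) →ₗ[𝕜] (X × Y)) = V₁.prod V₂

/-- `X` and `Y` are complementably incomparable: isomorphic complemented subspaces of `X` and `Y`
are finite-dimensional. -/
def ComplementablyIncomparable : Prop :=
  ∀ (V : Submodule 𝕜 X) (W : Submodule 𝕜 Y), V.ClosedComplemented → W.ClosedComplemented →
    Nonempty (V ≃L[𝕜] W) → FiniteDimensional 𝕜 V

end Splitting

/-! ### Natural spaces and proper envelopes -/

/-- The real vector space underlying a vector space over `𝕜 = ℝ` or `ℂ`. -/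
abbrev realModule (𝕜 : Type*) (X : Type*) [RCLike 𝕜] [AddCommGroup X] [Module 𝕜 X] : Module ℝ X :=
  Module.compHom X (algebraMap ℝ 𝕜)

/-- Local convexity of a topological vector space over `𝕜 = ℝ` or `ℂ`. -/
def IsLocallyConvex (𝕜 : Type*) (X : Type*) [RCLike 𝕜] [AddCommGroup X] [Module 𝕜 X]
    [TopologicalSpace X] : Prop :=
  letI := realModule 𝕜 X
  LocallyConvexSpace ℝ X

/-- A (real) quasi-Banach lattice: a quasi-Banach space that is a vector lattice with a quasi-norm
that is monotone with respect to the modulus. -/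
class IsQuasiBanachLattice (L : Type*) [AddCommGroup L] [Module ℝ L] [TopologicalSpace L]
    [IsTopologicalAddGroup L] [ContinuousSMul ℝ L] [QuasiBanachSpace ℝ L] [Lattice L] : Prop
    extends IsOrderedAddMonoid L, IsOrderedModule ℝ L where
  solid : ∀ x y : L, |x| ≤ |y| → QuasiBanachSpace.qnorm ℝ x ≤ QuasiBanachSpace.qnorm ℝ y

/-- Kalton's `L`-convexity: if `0 ≤ f i ≤ g` and the average of the `f i` is at least `(1 - ε) g`,
then some `f i` has quasi-norm at least `ε ‖g‖`. -/
def IsLConvex (L : Type*) [AddCommGroup L] [Module ℝ L] [TopologicalSpace L]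
    [IsTopologicalAddGroup L] [ContinuousSMul ℝ L] [QuasiBanachSpace ℝ L] [Lattice L] : Prop :=
  ∃ ε : ℝ, 0 < ε ∧ ∀ (k : ℕ), 0 < k → ∀ (g : L) (f : Fin k → L),
    (∀ i, 0 ≤ f i ∧ f i ≤ g) → ((1 - ε) * (k : ℝ)) • g ≤ ∑ i, f i →
      ∃ i, ε * QuasiBanachSpace.qnorm ℝ g ≤ QuasiBanachSpace.qnorm ℝ (f i)

/-- `X` is natural: it is isomorphic to a subspace of an `L`-convex quasi-Banach lattice.
For `𝕜 = ℂ` the embedding is real-linear into the real lattice `L`; this is the same as a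
complex-linear embedding into the complexification of such a lattice, since a real-linear embedding
`T` gives the complex-linear embedding `x ↦ T x - i T (i x)` into `L ⊕ i L`, and the real space
underlying `L ⊕ i L` is the lattice `L × L`. -/
def IsNatural (𝕜 : Type*) (X : Type u) [RCLike 𝕜] [AddCommGroup X] [Module 𝕜 X]
    [TopologicalSpace X] : Prop :=
  letI := realModule 𝕜 X
  ∃ (L : Type u) (_ : AddCommGroup L) (_ : Module ℝ L) (_ : TopologicalSpace L)
    (_ : IsTopologicalAddGroup L) (_ : ContinuousSMul ℝ L) (_ : QuasiBanachSpace ℝ L)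
    (_ : Lattice L) (_ : IsQuasiBanachLattice L),
    IsLConvex L ∧ ∃ T : X →ₗ[ℝ] L, IsEmbedding T

/-- The Banach space `U` is a proper envelope: it is isomorphic to the Banach envelope of a
non-locally convex quasi-Banach space `Y`. As always when Banach envelopes are compared with the
original space, the dual of `Y` is required to separate points (equivalently, the envelope map is
injective): otherwise `Y = U ⊕ L_p[0,1]` with `p < 1`, whose envelope is `U`, would make every `U` a
proper envelope. In particular `Y` injects into `U`, so the size of the universe of `Y` is
immaterial as soon as it contains `U`. -/
def IsProperEnvelope (𝕜 : Type*) (U : Type v) [RCLike 𝕜] [NormedAddCommGroup U]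
    [NormedSpace 𝕜 U] : Prop :=
  ∃ (Y : Type w) (_ : AddCommGroup Y) (_ : Module 𝕜 Y) (_ : TopologicalSpace Y)
    (_ : IsTopologicalAddGroup Y) (_ : ContinuousSMul 𝕜 Y) (_ : QuasiBanachSpace 𝕜 Y),
    SeparatingDual 𝕜 Y ∧ ¬ IsLocallyConvex 𝕜 Y ∧ Nonempty (BanachEnvelope 𝕜 Y ≃L[𝕜] U)

/-- The Banach space `U` is a proper envelope of a natural space; same convention as for
`IsProperEnvelope`. -/
def IsProperEnvelopeOfNatural (𝕜 : Type*) (U : Type v) [RCLike 𝕜] [NormedAddCommGroup U]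
    [NormedSpace 𝕜 U] : Prop :=
  ∃ (Y : Type w) (_ : AddCommGroup Y) (_ : Module 𝕜 Y) (_ : TopologicalSpace Y)
    (_ : IsTopologicalAddGroup Y) (_ : ContinuousSMul 𝕜 Y) (_ : QuasiBanachSpace 𝕜 Y),
    SeparatingDual 𝕜 Y ∧ IsNatural 𝕜 Y ∧ ¬ IsLocallyConvex 𝕜 Y ∧
      Nonempty (BanachEnvelope 𝕜 Y ≃L[𝕜] U)

/-!
Write `J : X → X̂` for the envelope map. An unconditional basis `b` of `X ⊕ U` induces one of the
envelope `X̂ ⊕ U`, because the partial sum operators are uniformly bounded and extend to the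
envelope. Splitting there produces `A` such that the spans of `b` over `A` and its complement have
envelopes isomorphic to `X̂` and `U`. These spans are complementary in `X ⊕ U`, so they are
isomorphic to `V₁ ⊕ V₂` and `W₁ ⊕ W₂` with `X = V₁ ⊕ W₁` and `U = V₂ ⊕ W₂`. Passing to envelopes,
`X̂ ≃ V̂₁ ⊕ V₂` and `U ≃ Ŵ₁ ⊕ W₂`, so incomparability makes `V₂` and `Ŵ₁`, hence also `W₁`,
finite-dimensional. The two spans therefore differ from `X` and `U` by finite-dimensional summands
only, which is repaired by moving finitely many basis vectors from one set to the other.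
-/

/-! ### Quasi-Banach spaces -/

namespace QuasiBanachSpace

variable {𝕜 : Type*} [RCLike 𝕜]
  {E : Type*} [AddCommGroup E] [Module 𝕜 E] [TopologicalSpace E] [IsTopologicalAddGroup E]
  [ContinuousSMul 𝕜 E] [QuasiBanachSpace 𝕜 E]

theorem qnorm_zero : qnorm 𝕜 (0 : E) = 0 := (qnorm_eq_zero _).2 rfl

theorem qnorm_pos {x : E} (hx : x ≠ 0) : 0 < qnorm 𝕜 x :=
  (qnorm_nonneg x).lt_of_ne fun h => hx ((qnorm_eq_zero x).1 h.symm)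

theorem qnorm_neg (x : E) : qnorm 𝕜 (-x) = qnorm 𝕜 x := by
  simpa using qnorm_smul (-1 : 𝕜) x

theorem qnorm_sub_comm (x y : E) : qnorm 𝕜 (x - y) = qnorm 𝕜 (y - x) := by
  rw [← qnorm_neg, neg_sub]

theorem nhds_zero_eq_comap_qnorm : 𝓝 (0 : E) = comap (qnorm 𝕜) (𝓝 0) := by
  refine (nhds_zero_basis (𝕜 := 𝕜)).eq_of_same_basis ((Metric.nhds_basis_ball.comap _).congr
    (fun _ => Iff.rfl) fun ε _ => ?_)
  ext x
  simp only [Set.mem_preimage, Metric.mem_ball, Real.dist_0_eq_abs,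
    abs_of_nonneg (qnorm_nonneg _), Set.mem_ofPred_eq]

theorem tendsto_iff_tendsto_qnorm {α : Type*} {l : Filter α} {s : α → E} {x : E} :
    Tendsto s l (𝓝 x) ↔ Tendsto (fun i => qnorm 𝕜 (s i - x)) l (𝓝 0) := by
  rw [← tendsto_sub_nhds_zero_iff, nhds_zero_eq_comap_qnorm (𝕜 := 𝕜), tendsto_comap_iff]
  rfl

theorem exists_smul_qnorm_eq {x : E} (hx : x ≠ 0) {δ : ℝ} (hδ : 0 < δ) :
    ∃ a : 𝕜, 0 < ‖a‖ ∧ ‖a‖ * qnorm 𝕜 x = δ := by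
  have hx₀ : 0 < qnorm 𝕜 x := qnorm_pos hx
  refine ⟨(δ / qnorm 𝕜 x : ℝ), ?_, ?_⟩ <;> rw [RCLike.norm_ofReal, abs_of_pos (by positivity)]
  · positivity
  · exact div_mul_cancel₀ δ hx₀.ne'

theorem exists_seminorm_le_mul_qnorm {p : Seminorm 𝕜 E} (hp : Continuous p) :
    ∃ C, 0 < C ∧ ∀ x, p x ≤ C * qnorm 𝕜 x := by
  have hnear : ∀ᶠ x in 𝓝 0, p x < 1 :=
    (hp.tendsto' 0 0 (map_zero p)).eventually_lt_const one_pos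
  obtain ⟨δ, hδ, hsub⟩ := (nhds_zero_basis (𝕜 := 𝕜)).mem_iff.1 hnear
  refine ⟨(δ / 2)⁻¹, by positivity, fun x => ?_⟩
  rcases eq_or_ne x 0 with rfl | hx
  · rw [qnorm_zero, map_zero, mul_zero]
  obtain ⟨a, ha, hax⟩ := exists_smul_qnorm_eq (𝕜 := 𝕜) hx (half_pos hδ)
  have hpa : p (a • x) < 1 := hsub (by
    rw [Set.mem_ofPred_eq, qnorm_smul, hax]
    exact half_lt_self hδ)
  rw [← hax, mul_inv, mul_assoc, inv_mul_cancel₀ (qnorm_pos hx).ne', mul_one,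
    ← one_div, le_div_iff₀ ha, mul_comm, ← map_smul_eq_mul p]
  exact hpa.le

section Topology

variable (𝕜 E)

include 𝕜

theorem t2Space : T2Space E :=
  IsTopologicalAddGroup.t2Space_of_zero_sep fun x hx =>
    ⟨{y | qnorm 𝕜 y < qnorm 𝕜 x}, (nhds_zero_basis (𝕜 := 𝕜)).mem_of_mem (qnorm_pos hx),
      lt_irrefl (qnorm 𝕜 x)⟩

theorem isCountablyGenerated_uniformity :
    (@uniformity E (IsTopologicalAddGroup.rightUniformSpace E)).IsCountablyGenerated := by
  let _ := IsTopologicalAddGroup.rightUniformSpace E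
  have : IsUniformAddGroup E := isUniformAddGroup_of_addCommGroup
  have : (𝓝 (0 : E)).IsCountablyGenerated := by
    rw [nhds_zero_eq_comap_qnorm (𝕜 := 𝕜)]
    infer_instance
  exact IsUniformAddGroup.uniformity_countably_generated

theorem completeSpace : @CompleteSpace E (IsTopologicalAddGroup.rightUniformSpace E) := by
  let _ := IsTopologicalAddGroup.rightUniformSpace E
  have : IsUniformAddGroup E := isUniformAddGroup_of_addCommGroup
  have := isCountablyGenerated_uniformity 𝕜 E
  refine UniformSpace.complete_of_cauchySeq_tendsto fun s hs => complete (𝕜 := 𝕜) s fun ε hε => ?_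
  have hmem : {p : E × E | qnorm 𝕜 (p.2 - p.1) < ε} ∈ uniformity E := by
    rw [uniformity_eq_comap_nhds_zero]
    exact preimage_mem_comap ((nhds_zero_basis (𝕜 := 𝕜)).mem_of_mem hε)
  obtain ⟨N, hN⟩ := cauchySeq_iff.1 hs _ hmem
  exact ⟨N, fun m hm n hn => hN n hn m hm⟩

theorem baireSpace : BaireSpace E := by
  let _ := IsTopologicalAddGroup.rightUniformSpace E
  have := isCountablyGenerated_uniformity 𝕜 E
  have := completeSpace 𝕜 E
  infer_instance

end Topology

instance ofBanach {U : Type*} [NormedAddCommGroup U] [NormedSpace 𝕜 U] [CompleteSpace U] :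
    QuasiBanachSpace 𝕜 U where
  qnorm := norm
  qnorm_nonneg := norm_nonneg
  qnorm_eq_zero _ := norm_eq_zero
  qnorm_smul := norm_smul
  exists_modulus := ⟨1, le_rfl, fun x y => by simpa using norm_add_le x y⟩
  nhds_zero_basis := by
    refine (Metric.nhds_basis_ball (x := (0 : U))).to_hasBasis
      (fun ε hε => ⟨ε, hε, fun x hx => mem_ball_zero_iff.2 hx⟩)
      (fun ε hε => ⟨ε, hε, fun x hx => mem_ball_zero_iff.1 hx⟩)
  complete s hs := by
    refine cauchySeq_tendsto_of_complete (Metric.cauchySeq_iff.2 fun ε hε => ?_)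
    obtain ⟨N, hN⟩ := hs ε hε
    exact ⟨N, fun m hm n hn => by simpa [dist_eq_norm] using hN m hm n hn⟩

variable {F : Type*} [AddCommGroup F] [Module 𝕜 F] [TopologicalSpace F]
  [IsTopologicalAddGroup F] [ContinuousSMul 𝕜 F] [QuasiBanachSpace 𝕜 F]

instance prod : QuasiBanachSpace 𝕜 (E × F) where
  qnorm z := max (qnorm 𝕜 z.1) (qnorm 𝕜 z.2)
  qnorm_nonneg z := le_max_of_le_left (qnorm_nonneg _)
  qnorm_eq_zero z := by
    constructor
    · intro h
      have h1 : qnorm 𝕜 z.1 = 0 :=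
        le_antisymm (h ▸ le_max_left _ _) (qnorm_nonneg _)
      have h2 : qnorm 𝕜 z.2 = 0 :=
        le_antisymm (h ▸ le_max_right _ _) (qnorm_nonneg _)
      exact Prod.ext ((qnorm_eq_zero _).1 h1) ((qnorm_eq_zero _).1 h2)
    · rintro rfl
      simp [qnorm_zero]
  qnorm_smul a z := by
    simp only [Prod.smul_fst, Prod.smul_snd, qnorm_smul]
    exact (mul_max_of_nonneg _ _ (norm_nonneg a)).symm
  exists_modulus := by
    obtain ⟨κ₁, h₁, hq₁⟩ := exists_modulus (𝕜 := 𝕜) (X := E)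
    obtain ⟨κ₂, -, hq₂⟩ := exists_modulus (𝕜 := 𝕜) (X := F)
    refine ⟨max κ₁ κ₂, le_max_of_le_left h₁, fun x y => max_le ?_ ?_⟩
    · refine (hq₁ _ _).trans (mul_le_mul (le_max_left _ _)
        (add_le_add (le_max_left _ _) (le_max_left _ _))
        (add_nonneg (qnorm_nonneg _) (qnorm_nonneg _)) (le_max_of_le_left (by linarith)))
    · refine (hq₂ _ _).trans (mul_le_mul (le_max_right _ _)
        (add_le_add (le_max_right _ _) (le_max_right _ _))
        (add_nonneg (qnorm_nonneg _) (qnorm_nonneg _)) (le_max_of_le_left (by linarith)))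
  nhds_zero_basis := by
    rw [← Prod.mk_zero_zero, nhds_prod_eq]
    refine ((nhds_zero_basis (𝕜 := 𝕜) (X := E)).prod
      (nhds_zero_basis (𝕜 := 𝕜) (X := F))).to_hasBasis ?_ ?_
    · rintro ⟨ε, δ⟩ ⟨hε, hδ⟩
      exact ⟨min ε δ, lt_min hε hδ, fun z hz =>
        ⟨(le_max_left _ _).trans_lt (lt_of_lt_of_le (Set.mem_ofPred.1 hz) (min_le_left _ _)),
          (le_max_right _ _).trans_lt (lt_of_lt_of_le (Set.mem_ofPred.1 hz) (min_le_right _ _))⟩⟩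
    · intro ε hε
      exact ⟨(ε, ε), ⟨hε, hε⟩, fun z hz => Set.mem_ofPred.2 (max_lt hz.1 hz.2)⟩
  complete s hs := by
    obtain ⟨x, hx⟩ := complete (𝕜 := 𝕜) (fun n => (s n).1) fun ε hε => by
      obtain ⟨N, hN⟩ := hs ε hε
      exact ⟨N, fun m hm n hn => lt_of_le_of_lt (le_max_left _ _) (hN m hm n hn)⟩
    obtain ⟨y, hy⟩ := complete (𝕜 := 𝕜) (fun n => (s n).2) fun ε hε => by
      obtain ⟨N, hN⟩ := hs ε hε
      exact ⟨N, fun m hm n hn => lt_of_le_of_lt (le_max_right _ _) (hN m hm n hn)⟩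
    exact ⟨(x, y), hx.prodMk_nhds hy⟩

theorem tendsto_zero_of_le_mul_qnorm {p : E → ℝ} (hp : ∀ x, 0 ≤ p x) {C : ℝ}
    (h : ∀ x, p x ≤ C * qnorm 𝕜 x) : Tendsto p (𝓝 0) (𝓝 0) := by
  have hlim : Tendsto (qnorm 𝕜) (𝓝 (0 : E)) (𝓝 0) := by
    rw [nhds_zero_eq_comap_qnorm (𝕜 := 𝕜)]
    exact tendsto_comap
  exact squeeze_zero hp h (by simpa using hlim.const_mul C)

theorem continuous_seminorm_of_le {p : Seminorm 𝕜 E} {C : ℝ} (h : ∀ x, p x ≤ C * qnorm 𝕜 x) :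
    Continuous p :=
  Seminorm.continuous_of_continuousAt_zero (by
    rw [ContinuousAt, map_zero]
    exact tendsto_zero_of_le_mul_qnorm (apply_nonneg p) h)

theorem continuous_of_qnorm_le {T : E →ₗ[𝕜] F} {C : ℝ}
    (h : ∀ x, qnorm 𝕜 (T x) ≤ C * qnorm 𝕜 x) : Continuous T :=
  continuous_of_continuousAt_zero T (by
    rw [ContinuousAt, map_zero, tendsto_iff_tendsto_qnorm (𝕜 := 𝕜)]
    simpa using tendsto_zero_of_le_mul_qnorm (fun x => qnorm_nonneg (𝕜 := 𝕜) (T x)) h)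

theorem tendsto_of_tendsto_of_qnorm_sub_le {α β : Type*} {l : Filter α} {l' : Filter β} [l.NeBot]
    {G : α → β → E} {g : β → E} {L : α → E} {x : E} {u : α → ℝ} (hu : Tendsto u l (𝓝 0))
    (hG : ∀ i j, qnorm 𝕜 (g j - G i j) ≤ u i) (hGL : ∀ i, Tendsto (G i) l' (𝓝 (L i)))
    (hL : Tendsto L l (𝓝 x)) : Tendsto g l' (𝓝 x) := by
  let _ := IsTopologicalAddGroup.rightUniformSpace E
  have : IsUniformAddGroup E := isUniformAddGroup_of_addCommGroup
  have hunif : TendstoUniformly G g l := by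
    refine (IsTopologicalAddGroup.tendstoUniformly_iff _ _ _ rfl).2 fun V hV => ?_
    obtain ⟨ε, hε, hεV⟩ := (nhds_zero_basis (𝕜 := 𝕜)).mem_iff.1 hV
    filter_upwards [hu.eventually_lt_const hε] with i hi j
    refine hεV (Set.mem_ofPred.2 ?_)
    rw [qnorm_sub_comm]
    exact (hG i j).trans_lt hi
  exact hunif.tendsto_of_eventually_tendsto (.of_forall hGL) hL

section Geometric

variable {κ : ℝ}

theorem qnorm_sum_range_le (hκ : 1 ≤ κ)
    (hq : ∀ x y : E, qnorm 𝕜 (x + y) ≤ κ * (qnorm 𝕜 x + qnorm 𝕜 y)) (n : ℕ) (x : ℕ → E) :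
    qnorm 𝕜 (∑ k ∈ Finset.range n, x k) ≤ ∑ k ∈ Finset.range n, κ ^ (k + 1) * qnorm 𝕜 (x k) := by
  induction n generalizing x with
  | zero => simp [qnorm_zero]
  | succ n ih =>
    have ih' := mul_le_mul_of_nonneg_left (ih fun k => x (k + 1)) (zero_le_one.trans hκ)
    rw [Finset.mul_sum] at ih'
    calc qnorm 𝕜 (∑ k ∈ Finset.range (n + 1), x k)
        ≤ κ * qnorm 𝕜 (∑ k ∈ Finset.range n, x (k + 1)) + κ * qnorm 𝕜 (x 0) := by
          rw [Finset.sum_range_succ', ← mul_add]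
          exact hq _ _
      _ ≤ ∑ k ∈ Finset.range n, κ * (κ ^ (k + 1) * qnorm 𝕜 (x (k + 1))) + κ * qnorm 𝕜 (x 0) := by
          gcongr
      _ = ∑ k ∈ Finset.range (n + 1), κ ^ (k + 1) * qnorm 𝕜 (x k) := by
          rw [Finset.sum_range_succ']
          simp only [pow_succ', mul_assoc, pow_zero, one_mul]

theorem qnorm_sum_geometric_le (hκ : 1 ≤ κ)
    (hq : ∀ x y : E, qnorm 𝕜 (x + y) ≤ κ * (qnorm 𝕜 x + qnorm 𝕜 y)) {M : ℝ} (hM : 0 ≤ M)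
    {x : ℕ → E} (hx : ∀ k, qnorm 𝕜 (x k) ≤ M * (2 * κ)⁻¹ ^ k) (n : ℕ) :
    qnorm 𝕜 (∑ k ∈ Finset.range n, x k) ≤ 2 * κ * M := by
  have hκ₀ : 0 < κ := by linarith
  calc qnorm 𝕜 (∑ k ∈ Finset.range n, x k)
      ≤ ∑ k ∈ Finset.range n, κ ^ (k + 1) * qnorm 𝕜 (x k) := qnorm_sum_range_le hκ hq n x
    _ ≤ ∑ k ∈ Finset.range n, κ ^ (k + 1) * (M * (2 * κ)⁻¹ ^ k) := by
        gcongr with k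
        exact hx k
    _ = κ * M * ∑ k ∈ Finset.range n, (1 / 2 : ℝ) ^ k := by
        rw [Finset.mul_sum]
        refine Finset.sum_congr rfl fun k _ => ?_
        have : κ ^ k * (2 * κ)⁻¹ ^ k = (1 / 2) ^ k := by
          rw [← mul_pow, mul_inv_rev, mul_inv_cancel_left₀ hκ₀.ne', one_div]
        rw [← this]
        ring
    _ ≤ κ * M * 2 := by
        gcongr
        exact sum_geometric_two_le n
    _ = 2 * κ * M := by ring

theorem qnorm_le_of_tendsto (hκ : 1 ≤ κ)
    (hq : ∀ x y : E, qnorm 𝕜 (x + y) ≤ κ * (qnorm 𝕜 x + qnorm 𝕜 y)) {α : Type*} {l : Filter α}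
    [l.NeBot] {s : α → E} {x : E} (hs : Tendsto s l (𝓝 x)) {C : ℝ}
    (hC : ∀ᶠ i in l, qnorm 𝕜 (s i) ≤ C) : qnorm 𝕜 x ≤ κ * C := by
  have hlim : Tendsto (fun i => κ * (qnorm 𝕜 (s i - x) + C)) l (𝓝 (κ * C)) := by
    simpa using ((tendsto_iff_tendsto_qnorm.1 hs).add_const C).const_mul κ
  refine ge_of_tendsto hlim (hC.mono fun i hi => ?_)
  calc qnorm 𝕜 x = qnorm 𝕜 (x - s i + s i) := by rw [sub_add_cancel]
    _ ≤ κ * (qnorm 𝕜 (s i - x) + C) := by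
      rw [qnorm_sub_comm]
      exact (hq _ _).trans (by gcongr)

end Geometric

variable (𝕜 E) in
theorem exists_qnorm_sub_sum_geometric_le :
    ∃ r C : ℝ, 0 < r ∧ r < 1 ∧ ∀ (M : ℝ) (x : ℕ → E) (y : E), 0 ≤ M →
      (∀ k, qnorm 𝕜 (x k) ≤ M * r ^ k) →
      Tendsto (fun n => ∑ k ∈ Finset.range n, x k) atTop (𝓝 y) →
        ∀ m, qnorm 𝕜 (y - ∑ k ∈ Finset.range m, x k) ≤ C * M * r ^ m := by
  obtain ⟨κ, hκ, hq⟩ := exists_modulus (𝕜 := 𝕜) (X := E)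
  have : 0 < κ := by linarith
  refine ⟨(2 * κ)⁻¹, κ * (2 * κ), by positivity, inv_lt_one_of_one_lt₀ (by linarith),
    fun M x y hM hx hy m => ?_⟩
  have htail : ∀ᶠ n in atTop, qnorm 𝕜 (∑ k ∈ Finset.range n, x k - ∑ k ∈ Finset.range m, x k) ≤
      2 * κ * (M * (2 * κ)⁻¹ ^ m) := by
    filter_upwards [eventually_ge_atTop m] with n hn
    obtain ⟨d, rfl⟩ := Nat.exists_eq_add_of_le hn
    rw [Finset.sum_range_add, add_sub_cancel_left]
    refine qnorm_sum_geometric_le hκ hq (by positivity) (fun k => ?_) d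
    rw [mul_assoc, ← pow_add]
    exact hx _
  exact (qnorm_le_of_tendsto hκ hq (hy.sub_const _) htail).trans_eq (by ring)

theorem exists_qnorm_sum_le_of_summable {ι : Type*} {g : ι → E} (hg : Summable g) :
    ∃ R, ∀ s : Finset ι, qnorm 𝕜 (∑ n ∈ s, g n) ≤ R := by
  classical
  obtain ⟨κ, hκ, hq⟩ := exists_modulus (𝕜 := 𝕜) (X := E)
  obtain ⟨t, ht⟩ := hg.vanishing ((nhds_zero_basis (𝕜 := 𝕜)).mem_of_mem one_pos)
  refine ⟨κ * (∑ u ∈ t.powerset, qnorm 𝕜 (∑ n ∈ u, g n) + 1), fun s => ?_⟩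
  rw [← Finset.sum_inter_add_sum_sdiff s t]
  refine (hq _ _).trans ?_
  gcongr
  · exact Finset.single_le_sum (f := fun u => qnorm 𝕜 (∑ n ∈ u, g n))
      (fun _ _ => qnorm_nonneg _) (Finset.mem_powerset.2 Finset.inter_subset_right)
  · exact (ht _ Finset.sdiff_disjoint).le

section Zabreiko

variable {p : E → ℝ}

theorem exists_closure_setOf_le_mem_nhds_zero {K : ℝ} (hK : 0 ≤ K)
    (hp_smul : ∀ (a : 𝕜) x, p (a • x) = ‖a‖ * p x) (hp_add : ∀ x y, p (x + y) ≤ K * (p x + p y)) :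
    ∃ R, closure {x | p x ≤ R} ∈ 𝓝 (0 : E) := by
  have := baireSpace 𝕜 E
  have hcover : ⋃ n : ℕ, closure {x | p x ≤ n} = Set.univ :=
    Set.eq_univ_of_forall fun x =>
      let ⟨n, hn⟩ := exists_nat_ge (p x)
      Set.mem_iUnion.2 ⟨n, subset_closure hn⟩
  obtain ⟨n, x, hx⟩ := nonempty_interior_of_iUnion_of_closed (fun _ => isClosed_closure) hcover
  have hnear : ∀ᶠ z in 𝓝 (0 : E), x + z ∈ closure {x | p x ≤ n} := by
    have : Tendsto (fun z => x + z) (𝓝 0) (𝓝 x) := by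
      simpa using (continuous_const_add x).tendsto 0
    exact this.eventually (mem_interior_iff_mem_nhds.1 hx)
  refine ⟨K * (n + n), hnear.mono fun z hz => ?_⟩
  rw [← add_sub_cancel_left x z]
  refine map_mem_closure₂ continuous_sub hz (interior_subset hx) fun f hf g hg => ?_
  have hneg : p (-g) = p g := by simpa using hp_smul (-1) g
  calc p (f - g) ≤ K * (p f + p g) := by simpa only [sub_eq_add_neg, hneg] using hp_add f (-g)
    _ ≤ K * (n + n) := by gcongr <;> assumption

theorem exists_le_and_qnorm_sub_le (hp_smul : ∀ (a : 𝕜) x, p (a • x) = ‖a‖ * p x) {R : ℝ}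
    (hR : closure {x | p x ≤ R} ∈ 𝓝 (0 : E)) :
    ∃ c, 0 ≤ c ∧ ∀ (f : E) (ε : ℝ), 0 < ε →
      ∃ g, p g ≤ c * qnorm 𝕜 f ∧ qnorm 𝕜 (f - g) ≤ ε * qnorm 𝕜 f := by
  obtain ⟨δ, hδ, hsub⟩ := (nhds_zero_basis (𝕜 := 𝕜)).mem_iff.1 hR
  refine ⟨|R| / (δ / 2), by positivity, fun f ε hε => ?_⟩
  rcases eq_or_ne f 0 with rfl | hf
  · refine ⟨0, ?_, by simp [qnorm_zero]⟩
    rw [qnorm_zero, mul_zero, ← zero_smul 𝕜 (0 : E), hp_smul, norm_zero, zero_mul]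
  obtain ⟨a, ha, haf⟩ := exists_smul_qnorm_eq (𝕜 := 𝕜) hf (half_pos hδ)
  have ha₀ : a ≠ 0 := norm_pos_iff.1 ha
  have hmem : a • f ∈ closure {x | p x ≤ R} := hsub (by
    rw [Set.mem_ofPred_eq, qnorm_smul, haf]
    exact half_lt_self hδ)
  have hball : ∀ᶠ g in 𝓝 (a • f), qnorm 𝕜 (g - a • f) < ε * (δ / 2) :=
    (tendsto_iff_tendsto_qnorm.1 tendsto_id).eventually_lt_const (by positivity)
  obtain ⟨g, hgR, hg⟩ := (mem_closure_iff_frequently.1 hmem).and_eventually hball |>.exists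
  refine ⟨a⁻¹ • g, ?_, ?_⟩
  · rw [hp_smul, norm_inv, inv_mul_le_iff₀ ha, mul_left_comm, haf,
      div_mul_cancel₀ _ (half_pos hδ).ne']
    exact (Set.mem_ofPred.1 hgR).trans (le_abs_self R)
  · have : f - a⁻¹ • g = a⁻¹ • (a • f - g) := by rw [smul_sub, inv_smul_smul₀ ha₀]
    rw [this, qnorm_smul, qnorm_sub_comm, norm_inv, inv_mul_le_iff₀ ha, mul_left_comm, haf]
    exact hg.le

/-- Zabreiko's lemma for quasi-norms: by Baire's theorem every vector is approximated by vectors on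
which `p` is controlled by the quasi-norm, and iterating on the error writes it as a series. -/
theorem exists_le_mul_qnorm_of_geometric_series {K : ℝ} (hK : 0 ≤ K)
    (hp_smul : ∀ (a : 𝕜) x, p (a • x) = ‖a‖ * p x) (hp_add : ∀ x y, p (x + y) ≤ K * (p x + p y))
    {r C : ℝ} (hr₀ : 0 < r) (hr₁ : r < 1)
    (hp_series : ∀ (M : ℝ) (x : ℕ → E) (f : E), 0 ≤ M → (∀ k, p (x k) ≤ M * r ^ k) →
      Tendsto (fun n => ∑ k ∈ Finset.range n, x k) atTop (𝓝 f) → p f ≤ C * M) :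
    ∃ C', ∀ f, p f ≤ C' * qnorm 𝕜 f := by
  obtain ⟨R, hR⟩ := exists_closure_setOf_le_mem_nhds_zero hK hp_smul hp_add
  obtain ⟨c, hc, happrox⟩ := exists_le_and_qnorm_sub_le hp_smul hR
  choose g hgp hgr using fun f => happrox f r hr₀
  refine ⟨C * c, fun f => ?_⟩
  let err : ℕ → E := fun k => (fun h => h - g h)^[k] f
  have err_succ : ∀ k, err (k + 1) = err k - g (err k) := fun k =>
    Function.iterate_succ_apply' _ _ _
  have qnorm_err : ∀ k, qnorm 𝕜 (err k) ≤ qnorm 𝕜 f * r ^ k := by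
    intro k
    induction k with
    | zero => simp [err]
    | succ k ih =>
      calc qnorm 𝕜 (err (k + 1)) ≤ r * qnorm 𝕜 (err k) := err_succ k ▸ hgr (err k)
        _ ≤ r * (qnorm 𝕜 f * r ^ k) := by gcongr
        _ = qnorm 𝕜 f * r ^ (k + 1) := by ring
  have sum_eq : ∀ n, ∑ k ∈ Finset.range n, g (err k) = f - err n := by
    intro n
    induction n with
    | zero => simp [err]
    | succ n ih => rw [Finset.sum_range_succ, ih, err_succ]; abel
  have hsum : Tendsto (fun n => ∑ k ∈ Finset.range n, g (err k)) atTop (𝓝 f) := by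
    rw [tendsto_iff_tendsto_qnorm (𝕜 := 𝕜)]
    have := (tendsto_pow_atTop_nhds_zero_of_lt_one hr₀.le hr₁).const_mul (qnorm 𝕜 f)
    refine squeeze_zero (fun _ => qnorm_nonneg _) (fun n => ?_) (by simpa using this)
    rw [sum_eq, sub_sub_cancel_left, qnorm_neg]
    exact qnorm_err n
  have hterm : ∀ k, p (g (err k)) ≤ c * qnorm 𝕜 f * r ^ k := fun k =>
    (hgp _).trans ((mul_le_mul_of_nonneg_left (qnorm_err k) hc).trans_eq (mul_assoc _ _ _).symm)
  rw [mul_assoc]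
  exact hp_series _ _ f (mul_nonneg hc (qnorm_nonneg f)) hterm hsum

end Zabreiko

end QuasiBanachSpace

/-! ### Unconditional bases -/

section ClosedSpan

variable {𝕜 : Type*} [RCLike 𝕜]
  {E : Type*} [AddCommGroup E] [Module 𝕜 E] [TopologicalSpace E] [IsTopologicalAddGroup E]
  [ContinuousSMul 𝕜 E] {ι : Type*} {b : ι → E} {A B : Set ι}

theorem mem_closedSpan {n : ι} (hn : n ∈ A) : b n ∈ closedSpan 𝕜 b A :=
  Submodule.le_topologicalClosure _ (Submodule.subset_span (Set.mem_image_of_mem b hn))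

theorem closedSpan_le {p : Submodule 𝕜 E} (hp : IsClosed (p : Set E)) (h : ∀ n ∈ A, b n ∈ p) :
    closedSpan 𝕜 b A ≤ p :=
  Submodule.topologicalClosure_minimal _ (Submodule.span_le.2 (Set.image_subset_iff.2 h)) hp

theorem closedSpan_mono (h : A ⊆ B) : closedSpan 𝕜 b A ≤ closedSpan 𝕜 b B :=
  closedSpan_le (Submodule.isClosed_topologicalClosure _) fun _ hn => mem_closedSpan (h hn)

theorem eq_of_mem_closedSpan {F : Type*} [AddCommGroup F] [Module 𝕜 F] [TopologicalSpace F]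
    [T2Space F] {S T : E →L[𝕜] F} (h : ∀ n ∈ A, S (b n) = T (b n)) {x : E}
    (hx : x ∈ closedSpan 𝕜 b A) : S x = T x :=
  closedSpan_le (p := LinearMap.eqLocus S.toLinearMap T.toLinearMap)
    (isClosed_eq S.continuous T.continuous) h hx

end ClosedSpan

namespace IsUnconditionalBasis

open QuasiBanachSpace

variable {𝕜 : Type*} [RCLike 𝕜]
  {E : Type*} [AddCommGroup E] [Module 𝕜 E] [TopologicalSpace E] [IsTopologicalAddGroup E]
  [ContinuousSMul 𝕜 E] {ι : Type*} {b : ι → E}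

/-- The coefficients of a vector with respect to an unconditional basis. -/
noncomputable def coeff (hb : IsUnconditionalBasis 𝕜 b) (f : E) : ι → 𝕜 :=
  (hb.existsUnique_hasSum f).choose

theorem hasSum_coeff (hb : IsUnconditionalBasis 𝕜 b) (f : E) :
    HasSum (fun n => hb.coeff f n • b n) f :=
  (hb.existsUnique_hasSum f).choose_spec.1

theorem coeff_eq (hb : IsUnconditionalBasis 𝕜 b) {f : E} {a : ι → 𝕜}
    (h : HasSum (fun n => a n • b n) f) : hb.coeff f = a :=
  ((hb.existsUnique_hasSum f).choose_spec.2 a h).symm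

/-- The coordinate functionals as linear maps; they are continuous by `continuous_coord`. -/
noncomputable def coord (hb : IsUnconditionalBasis 𝕜 b) (n : ι) : E →ₗ[𝕜] 𝕜 where
  toFun f := hb.coeff f n
  map_add' f g := by
    have h := (hb.hasSum_coeff f).add (hb.hasSum_coeff g)
    simp only [← add_smul] at h
    exact congrFun (hb.coeff_eq h) n
  map_smul' c f := by
    have h := (hb.hasSum_coeff f).const_smul c
    simp only [← mul_smul] at h
    exact congrFun (hb.coeff_eq h) n

theorem hasSum_coord (hb : IsUnconditionalBasis 𝕜 b) (f : E) :
    HasSum (fun n => hb.coord n f • b n) f := hb.hasSum_coeff f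

theorem coord_eq (hb : IsUnconditionalBasis 𝕜 b) {f : E} {a : ι → 𝕜}
    (h : HasSum (fun n => a n • b n) f) (n : ι) : hb.coord n f = a n :=
  congrFun (hb.coeff_eq h) n

open Classical in
theorem coord_apply (hb : IsUnconditionalBasis 𝕜 b) (m n : ι) :
    hb.coord m (b n) = if m = n then 1 else 0 := by
  refine hb.coord_eq (a := fun m => if m = n then 1 else 0) ?_ m
  have h := hasSum_single (f := fun m => (if m = n then (1 : 𝕜) else 0) • b m) n
    fun m hm => by simp [hm]
  simpa using h

theorem ne_zero (hb : IsUnconditionalBasis 𝕜 b) (n : ι) : b n ≠ 0 := by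
  intro h
  simpa [h] using hb.coord_apply n n

/-- The partial sum operator of the basis expansion over a finite set of indices. -/
noncomputable def partialSum (hb : IsUnconditionalBasis 𝕜 b) (s : Finset ι) : E →ₗ[𝕜] E :=
  ∑ n ∈ s, (hb.coord n).smulRight (b n)

theorem partialSum_apply (hb : IsUnconditionalBasis 𝕜 b) (s : Finset ι) (f : E) :
    hb.partialSum s f = ∑ n ∈ s, hb.coord n f • b n := by
  simp [partialSum]

theorem tendsto_partialSum (hb : IsUnconditionalBasis 𝕜 b) (f : E) :
    Tendsto (fun s => hb.partialSum s f) atTop (𝓝 f) := by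
  simpa only [partialSum_apply, HasSum, SummationFilter.unconditional_filter] using
    hb.hasSum_coord f

theorem of_biorthogonal [T2Space E] [Countable ι] {φ : ι → E →L[𝕜] 𝕜}
    (hφ : ∀ m n, m ≠ n → φ m (b n) = 0) (hφ₁ : ∀ n, φ n (b n) = 1)
    (hsum : ∀ f, HasSum (fun n => φ n f • b n) f) : IsUnconditionalBasis 𝕜 b where
  countable := ‹_›
  closedSpan_eq_top := by
    refine eq_top_iff.2 fun f _ => (Submodule.isClosed_topologicalClosure _).mem_of_tendsto
      (hsum f) (.of_forall fun s => sum_mem fun n _ => Submodule.smul_mem _ _ ?_)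
    exact mem_closedSpan (Set.mem_univ n)
  existsUnique_hasSum f := by
    refine ⟨fun n => φ n f, hsum f, fun a ha => funext fun m => ?_⟩
    have h := (φ m).hasSum ha
    have h' := hasSum_single (f := fun n => φ m (a n • b n)) m fun n hn => by
      rw [map_smul, hφ m n hn.symm, smul_zero]
    have := h'.unique h
    rwa [map_smul, hφ₁, smul_eq_mul, mul_one] at this

variable [QuasiBanachSpace 𝕜 E]

/-- The supremum of the quasi-norms of the partial sums of the expansion of a vector: an a priori
discontinuous quasi-norm, to which Zabreiko's lemma is applied. -/
noncomputable def supNorm (hb : IsUnconditionalBasis 𝕜 b) (f : E) : ℝ :=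
  ⨆ s, qnorm 𝕜 (hb.partialSum s f)

theorem qnorm_partialSum_le_supNorm (hb : IsUnconditionalBasis 𝕜 b) (s : Finset ι) (f : E) :
    qnorm 𝕜 (hb.partialSum s f) ≤ hb.supNorm f := by
  obtain ⟨R, hR⟩ := exists_qnorm_sum_le_of_summable (𝕜 := 𝕜) (hb.hasSum_coord f).summable
  refine le_ciSup (f := fun s => qnorm 𝕜 (hb.partialSum s f))
    ⟨R, Set.forall_mem_range.2 fun s => ?_⟩ s
  rw [partialSum_apply]
  exact hR s

theorem supNorm_smul (hb : IsUnconditionalBasis 𝕜 b) (a : 𝕜) (f : E) :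
    hb.supNorm (a • f) = ‖a‖ * hb.supNorm f := by
  simp only [supNorm, map_smul, qnorm_smul, Real.mul_iSup_of_nonneg (norm_nonneg a)]

theorem supNorm_add_le (hb : IsUnconditionalBasis 𝕜 b) {κ : ℝ} (hκ : 0 ≤ κ)
    (hq : ∀ x y : E, qnorm 𝕜 (x + y) ≤ κ * (qnorm 𝕜 x + qnorm 𝕜 y)) (f g : E) :
    hb.supNorm (f + g) ≤ κ * (hb.supNorm f + hb.supNorm g) := by
  refine ciSup_le fun s => ?_
  rw [map_add]
  refine (hq _ _).trans ?_
  gcongr <;> exact hb.qnorm_partialSum_le_supNorm s _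

theorem norm_coord_mul_qnorm_le_supNorm (hb : IsUnconditionalBasis 𝕜 b) (n : ι) (f : E) :
    ‖hb.coord n f‖ * qnorm 𝕜 (b n) ≤ hb.supNorm f := by
  simpa [partialSum_apply, qnorm_smul] using hb.qnorm_partialSum_le_supNorm {n} f

theorem tendsto_sum_partialSum (hb : IsUnconditionalBasis 𝕜 b) {M r : ℝ} (hr₀ : 0 ≤ r)
    (hr₁ : r < 1) {x : ℕ → E} (hx : ∀ k, hb.supNorm (x k) ≤ M * r ^ k) (s : Finset ι) :
    Tendsto (fun m => ∑ k ∈ Finset.range m, hb.partialSum s (x k)) atTop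
      (𝓝 (∑ n ∈ s, (∑' k, hb.coord n (x k)) • b n)) := by
  have hsummable : ∀ n, Summable fun k => hb.coord n (x k) := fun n => by
    refine .of_norm_bounded (g := fun k => M / qnorm 𝕜 (b n) * r ^ k)
      ((summable_geometric_of_lt_one hr₀ hr₁).mul_left _) fun k => ?_
    rw [div_mul_eq_mul_div, le_div_iff₀ (qnorm_pos (hb.ne_zero n))]
    exact (hb.norm_coord_mul_qnorm_le_supNorm n _).trans (hx k)
  refine (tendsto_finsetSum s fun n _ =>
    ((hsummable n).hasSum.tendsto_sum_nat).smul_const (b n)).congr fun m => ?_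
  simp only [partialSum_apply, Finset.sum_smul]
  exact Finset.sum_comm

theorem exists_partialSum_bound (hb : IsUnconditionalBasis 𝕜 b) :
    ∃ C, ∀ s f, qnorm 𝕜 (hb.partialSum s f) ≤ C * qnorm 𝕜 f := by
  have := t2Space 𝕜 E
  obtain ⟨κ, hκ, hq⟩ := exists_modulus (𝕜 := 𝕜) (X := E)
  obtain ⟨r, C, hr₀, hr₁, hgeom⟩ := exists_qnorm_sub_sum_geometric_le 𝕜 E
  have hκ₀ : 0 ≤ κ := zero_le_one.trans hκ
  suffices h : ∃ C', ∀ f, hb.supNorm f ≤ C' * qnorm 𝕜 f from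
    h.imp fun C' h s f => (hb.qnorm_partialSum_le_supNorm s f).trans (h f)
  refine exists_le_mul_qnorm_of_geometric_series hκ₀ hb.supNorm_smul (hb.supNorm_add_le hκ₀ hq)
    hr₀ hr₁ (C := C) fun M x f hM hx hf => ?_
  let y : Finset ι → E := fun s => ∑ n ∈ s, (∑' k, hb.coord n (x k)) • b n
  have hy : ∀ s m, qnorm 𝕜 (y s - ∑ k ∈ Finset.range m, hb.partialSum s (x k)) ≤ C * M * r ^ m :=
    fun s => hgeom M _ _ hM (fun k => (hb.qnorm_partialSum_le_supNorm s _).trans (hx k))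
      (hb.tendsto_sum_partialSum hr₀.le hr₁ hx s)
  have hpow : Tendsto (fun m => C * M * r ^ m) atTop (𝓝 0) := by
    simpa using (tendsto_pow_atTop_nhds_zero_of_lt_one hr₀.le hr₁).const_mul (C * M)
  -- The partial sums of `∑ x k` converge to `y s` uniformly in `s`, so the limits may be exchanged.
  have hyf : HasSum (fun n => (∑' k, hb.coord n (x k)) • b n) f :=
    tendsto_of_tendsto_of_qnorm_sub_le hpow (fun m s => hy s m)
      (fun m => by
        simpa only [map_sum, SummationFilter.unconditional_filter] using
          hb.tendsto_partialSum (∑ k ∈ Finset.range m, x k)) hf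
  have hPy : ∀ s, hb.partialSum s f = y s := fun s => by
    simp only [partialSum_apply, hb.coord_eq hyf, y]
  refine ciSup_le fun s => ?_
  simpa [hPy] using hy s 0

theorem continuous_coord (hb : IsUnconditionalBasis 𝕜 b) (n : ι) : Continuous (hb.coord n) := by
  obtain ⟨C, hC⟩ := hb.exists_partialSum_bound
  refine continuous_of_qnorm_le (𝕜 := 𝕜) (C := C / qnorm 𝕜 (b n)) fun f => ?_
  rw [div_mul_eq_mul_div, le_div_iff₀ (qnorm_pos (hb.ne_zero n))]
  change ‖hb.coord n f‖ * _ ≤ _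
  rw [← qnorm_smul]
  simpa only [partialSum_apply, Finset.sum_singleton] using hC {n} f

/-- The coordinate functionals as continuous linear maps. -/
noncomputable def coordL (hb : IsUnconditionalBasis 𝕜 b) (n : ι) : E →L[𝕜] 𝕜 :=
  ⟨hb.coord n, hb.continuous_coord n⟩

theorem separatingDual (hb : IsUnconditionalBasis 𝕜 b) : SeparatingDual 𝕜 E where
  exists_ne_zero' x hx := by
    by_contra! h
    have := t2Space 𝕜 E
    refine hx ((hb.hasSum_coord x).unique ?_)
    have hcoord : ∀ n, hb.coord n x = 0 := fun n => h (hb.coordL n)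
    simpa only [hcoord, zero_smul] using hasSum_zero

theorem exists_seminorm_partialSum_le (hb : IsUnconditionalBasis 𝕜 b) {q : Seminorm 𝕜 E}
    (hq : Continuous q) :
    ∃ p : Seminorm 𝕜 E, Continuous p ∧ ∀ s f, q (hb.partialSum s f) ≤ p f := by
  obtain ⟨C, hC⟩ := hb.exists_partialSum_bound
  obtain ⟨C', hC'₀, hC'⟩ := exists_seminorm_le_mul_qnorm hq
  have hle : ∀ s f, q.comp (hb.partialSum s) f ≤ C' * C * qnorm 𝕜 f := fun s f =>
    (hC' _).trans ((mul_le_mul_of_nonneg_left (hC s f) hC'₀.le).trans_eq (mul_assoc _ _ _).symm)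
  have hbdd : BddAbove (Set.range fun s => q.comp (hb.partialSum s)) :=
    Seminorm.bddAbove_range_iff.2 fun f => ⟨_, Set.forall_mem_range.2 fun s => hle s f⟩
  refine ⟨⨆ s, q.comp (hb.partialSum s), continuous_seminorm_of_le (C := C' * C) fun f => ?_,
    fun s f => le_ciSup hbdd s f⟩
  rw [Seminorm.iSup_apply hbdd]
  exact ciSup_le fun s => hle s f

theorem exists_proj (hb : IsUnconditionalBasis 𝕜 b) (A : Set ι) :
    ∃ P : E →L[𝕜] E, (∀ n ∈ A, P (b n) = b n) ∧ ∀ n ∉ A, P (b n) = 0 := by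
  classical
  let _ := IsTopologicalAddGroup.rightUniformSpace E
  have : IsUniformAddGroup E := isUniformAddGroup_of_addCommGroup
  have := completeSpace 𝕜 E
  have := t2Space 𝕜 E
  obtain ⟨κ, hκ, hq⟩ := exists_modulus (𝕜 := 𝕜) (X := E)
  obtain ⟨C, hC⟩ := hb.exists_partialSum_bound
  let F : E → ι → E := fun f => A.indicator fun n => hb.coord n f • b n
  have hlim : ∀ f, Tendsto (fun s : Finset ι => hb.partialSum (s.filter (· ∈ A)) f) atTop
      (𝓝 (∑' n, F f n)) := by
    intro f
    have h := ((hb.hasSum_coord f).summable.indicator A).hasSum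
    simpa only [HasSum, SummationFilter.unconditional_filter, partialSum_apply, Finset.sum_filter,
      F, Set.indicator_apply] using h
  let P := linearMapOfTendsto _ _ (tendsto_pi_nhds.2 hlim)
  have hP : Continuous P := continuous_of_qnorm_le fun f =>
    (qnorm_le_of_tendsto hκ hq (hlim f) (.of_forall fun s => hC _ f)).trans_eq
      (mul_assoc _ _ _).symm
  have hF : ∀ n, ∑' m, F (b n) m = A.indicator b n := by
    intro n
    rw [tsum_eq_single n fun m hm => by simp [F, coord_apply, hm]]
    simp [F, Set.indicator_apply, coord_apply]
  refine ⟨⟨P, hP⟩, fun n hn => ?_, fun n hn => ?_⟩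
  · exact (hF n).trans (Set.indicator_of_mem hn b)
  · exact (hF n).trans (Set.indicator_of_notMem hn b)

theorem isTopCompl_closedSpan_compl (hb : IsUnconditionalBasis 𝕜 b) (A : Set ι) :
    (closedSpan 𝕜 b A).IsTopCompl (closedSpan 𝕜 b Aᶜ) := by
  have := t2Space 𝕜 E
  obtain ⟨P, hP, hP₀⟩ := hb.exists_proj A
  have mem_of_map : ∀ (S : E →L[𝕜] E) (B : Set ι), (∀ n, S (b n) ∈ closedSpan 𝕜 b B) →
      ∀ x, S x ∈ closedSpan 𝕜 b B := fun S B h x =>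
    closedSpan_le (p := (closedSpan 𝕜 b B).comap S.toLinearMap) (A := Set.univ)
      ((Submodule.isClosed_topologicalClosure _).preimage S.continuous) (fun n _ => h n)
      (hb.closedSpan_eq_top ▸ trivial)
  have hmem : ∀ x, P x ∈ closedSpan 𝕜 b A := mem_of_map P A fun n => by
    by_cases hn : n ∈ A
    · simpa only [hP n hn] using mem_closedSpan hn
    · exact hP₀ n hn ▸ zero_mem _
  have hmem_compl : ∀ x, x - P x ∈ closedSpan 𝕜 b Aᶜ := mem_of_map (.id 𝕜 E - P) Aᶜ fun n => by
    by_cases hn : n ∈ A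
    · simp [hP n hn]
    · simpa [hP₀ n hn] using mem_closedSpan hn
  have hfix : ∀ x ∈ closedSpan 𝕜 b A, P x = x := fun x hx =>
    eq_of_mem_closedSpan (T := .id 𝕜 E) hP hx
  have hker : P.ker = closedSpan 𝕜 b Aᶜ := le_antisymm
    (fun x hx => by simpa [show P x = 0 from hx] using hmem_compl x)
    fun x hx => eq_of_mem_closedSpan (T := 0) hP₀ hx
  have hrange : P.range = closedSpan 𝕜 b A := le_antisymm
    (LinearMap.range_le_iff_comap.2 (Submodule.eq_top_iff'.2 hmem)) fun x hx => ⟨x, hfix x hx⟩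
  have hidem : IsIdempotentElem P := ContinuousLinearMap.ext fun x => hfix _ (hmem x)
  exact hrange ▸ hker ▸ ContinuousLinearMap.IsIdempotentElem.isTopCompl hidem

theorem nonempty_closedSpan_union_equiv (hb : IsUnconditionalBasis 𝕜 b) {A B : Set ι}
    (h : Disjoint A B) :
    Nonempty (closedSpan 𝕜 b (A ∪ B) ≃L[𝕜] (closedSpan 𝕜 b A × closedSpan 𝕜 b B)) := by
  have := t2Space 𝕜 E
  let P := Submodule.projectionOntoL _ _ (hb.isTopCompl_closedSpan_compl A)
  let Q := Submodule.projectionOntoL _ _ (hb.isTopCompl_closedSpan_compl B)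
  have hP : ∀ x : closedSpan 𝕜 b A, P x = x := Submodule.projectionOntoL_apply_left _
  have hQ : ∀ x : closedSpan 𝕜 b B, Q x = x := Submodule.projectionOntoL_apply_left _
  have hPB : ∀ x ∈ closedSpan 𝕜 b B, P x = 0 := fun x hx =>
    (Submodule.projectionOntoL_apply_eq_zero_iff _).2 (closedSpan_mono h.subset_compl_left hx)
  have hQA : ∀ x ∈ closedSpan 𝕜 b A, Q x = 0 := fun x hx =>
    (Submodule.projectionOntoL_apply_eq_zero_iff _).2 (closedSpan_mono h.subset_compl_right hx)
  have hPQ : ∀ x ∈ closedSpan 𝕜 b (A ∪ B), (P x + Q x : E) = x := fun x hx => by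
    refine eq_of_mem_closedSpan (T := .id 𝕜 E)
      (S := (closedSpan 𝕜 b A).subtypeL ∘L P + (closedSpan 𝕜 b B).subtypeL ∘L Q) ?_ hx
    rintro n (hn | hn)
    · simpa [hQA _ (mem_closedSpan hn)] using congrArg Subtype.val (hP ⟨b n, mem_closedSpan hn⟩)
    · simpa [hPB _ (mem_closedSpan hn)] using congrArg Subtype.val (hQ ⟨b n, mem_closedSpan hn⟩)
  refine ⟨.equivOfInverse ((P.prod Q) ∘L (closedSpan 𝕜 b (A ∪ B)).subtypeL)
    (((closedSpan 𝕜 b A).subtypeL.coprod (closedSpan 𝕜 b B).subtypeL).codRestrict _ fun x =>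
      add_mem (closedSpan_mono Set.subset_union_left x.1.2)
        (closedSpan_mono Set.subset_union_right x.2.2))
    (fun x => Subtype.ext (hPQ x x.2)) fun x => ?_⟩
  change (P (x.1 + x.2 : E), Q (x.1 + x.2 : E)) = x
  rw [map_add, map_add, hP, hQ, hPB _ x.2.2, hQA _ x.1.2, add_zero, zero_add]

end IsUnconditionalBasis

/-! ### Banach envelopes -/

/-- A continuous linear map `J` from a topological vector space to a normed space with dense range,
such that every continuous seminorm is dominated by a multiple of `‖J ·‖`: up to renorming, the
target is the Banach envelope as soon as it is complete. -/
structure IsEnvelopeMap {𝕜 E B : Type*} [RCLike 𝕜] [AddCommGroup E] [Module 𝕜 E]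
    [TopologicalSpace E] [NormedAddCommGroup B] [NormedSpace 𝕜 B] (J : E →L[𝕜] B) : Prop where
  denseRange : DenseRange J
  exists_seminorm_le : ∀ p : Seminorm 𝕜 E, Continuous p → ∃ C, ∀ x, p x ≤ C * ‖J x‖

section EnvelopeMap

open QuasiBanachSpace

variable {𝕜 : Type*} [RCLike 𝕜]
  {E : Type*} [AddCommGroup E] [Module 𝕜 E] [TopologicalSpace E]
  {E' : Type*} [AddCommGroup E'] [Module 𝕜 E'] [TopologicalSpace E']
  {B : Type*} [NormedAddCommGroup B] [NormedSpace 𝕜 B]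
  {B' : Type*} [NormedAddCommGroup B'] [NormedSpace 𝕜 B']
  {J : E →L[𝕜] B} {J' : E' →L[𝕜] B'}

namespace IsEnvelopeMap

theorem id : IsEnvelopeMap (.id 𝕜 B) where
  denseRange := denseRange_id
  exists_seminorm_le p hp :=
    (Seminorm.bound_of_continuous_normedSpace p hp).imp fun _ h => h.2

theorem prodMap (hJ : IsEnvelopeMap J) (hJ' : IsEnvelopeMap J') :
    IsEnvelopeMap (J.prodMap J') where
  denseRange := hJ.denseRange.prodMap hJ'.denseRange
  exists_seminorm_le p hp := by
    obtain ⟨C, hC⟩ := hJ.exists_seminorm_le (p.comp (.inl 𝕜 E E'))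
      (hp.comp (ContinuousLinearMap.inl 𝕜 E E').continuous)
    obtain ⟨C', hC'⟩ := hJ'.exists_seminorm_le (p.comp (.inr 𝕜 E E'))
      (hp.comp (ContinuousLinearMap.inr 𝕜 E E').continuous)
    refine ⟨|C| + |C'|, fun x => ?_⟩
    calc p x = p ((x.1, 0) + (0, x.2)) := by simp
      _ ≤ p (x.1, 0) + p (0, x.2) := map_add_le_add p _ _
      _ ≤ |C| * ‖J x.1‖ + |C'| * ‖J' x.2‖ := add_le_add
        ((hC x.1).trans (by gcongr; exact le_abs_self C))
        ((hC' x.2).trans (by gcongr; exact le_abs_self C'))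
      _ ≤ |C| * ‖J.prodMap J' x‖ + |C'| * ‖J.prodMap J' x‖ := by
        gcongr
        · exact norm_fst_le (J.prodMap J' x)
        · exact norm_snd_le (J.prodMap J' x)
      _ = (|C| + |C'|) * ‖J.prodMap J' x‖ := (add_mul _ _ _).symm

theorem exists_norm_le (hJ : IsEnvelopeMap J) (T : E →L[𝕜] B') :
    ∃ C, ∀ x, ‖T x‖ ≤ C * ‖J x‖ :=
  hJ.exists_seminorm_le ((normSeminorm 𝕜 B').comp T.toLinearMap) T.continuous.norm

theorem exists_extend [CompleteSpace B'] (hJ : IsEnvelopeMap J) (T : E →L[𝕜] B') :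
    ∃ S : B →L[𝕜] B', ∀ x, S (J x) = T x :=
  ⟨T.toLinearMap.extendOfNorm J.toLinearMap,
    LinearMap.extendOfNorm_eq hJ.denseRange (hJ.exists_norm_le T)⟩

theorem nonempty_equiv [CompleteSpace B] [CompleteSpace B'] (hJ : IsEnvelopeMap J)
    (hJ' : IsEnvelopeMap J') (e : E ≃L[𝕜] E') : Nonempty (B ≃L[𝕜] B') :=
  ⟨e.toLinearEquiv.extend J.toLinearMap J'.toLinearMap hJ.denseRange
    (hJ.exists_norm_le (J' ∘L (e : E →L[𝕜] E'))) hJ'.denseRange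
    (hJ'.exists_norm_le (J ∘L (e.symm : E' →L[𝕜] E)))⟩

theorem injective [SeparatingDual 𝕜 E] (hJ : IsEnvelopeMap J) : Function.Injective J := by
  refine (injective_iff_map_eq_zero J).2 fun x hx => ?_
  by_contra hx₀
  obtain ⟨f, hf⟩ := SeparatingDual.exists_ne_zero (R := 𝕜) hx₀
  obtain ⟨S, hS⟩ := hJ.exists_extend f
  rw [← hS, hx, map_zero] at hf
  exact hf rfl

end IsEnvelopeMap

/-- The closure of `J(V)`, which is an envelope of `V` if `V` is complemented. -/
abbrev envelopeSubmodule (J : E →L[𝕜] B) (V : Submodule 𝕜 E) : Submodule 𝕜 B :=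
  (V.map J.toLinearMap).topologicalClosure

/-- The restriction of `J` to a map from `V` to the closure of `J(V)`. -/
def envelopeRestrict (J : E →L[𝕜] B) (V : Submodule 𝕜 E) : V →L[𝕜] envelopeSubmodule J V :=
  (J ∘L V.subtypeL).codRestrict _ fun x =>
    Submodule.le_topologicalClosure _ (Submodule.mem_map_of_mem x.2)

theorem IsEnvelopeMap.restrict (hJ : IsEnvelopeMap J) {V : Submodule 𝕜 E}
    (hV : V.ClosedComplemented) : IsEnvelopeMap (envelopeRestrict J V) where
  denseRange := by
    rintro ⟨y, hy⟩
    rw [closure_subtype, ← Set.range_comp]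
    refine closure_mono ?_ hy
    rintro _ ⟨x, hx, rfl⟩
    exact ⟨⟨x, hx⟩, rfl⟩
  exists_seminorm_le p hp := by
    obtain ⟨P, hP⟩ := hV
    obtain ⟨C, hC⟩ := hJ.exists_seminorm_le (p.comp P.toLinearMap) (hp.comp P.continuous)
    refine ⟨C, fun x => ?_⟩
    have h := hC x
    rwa [Seminorm.comp_apply, ContinuousLinearMap.coe_coe, hP] at h

theorem IsEnvelopeMap.closedComplemented [CompleteSpace B] (hJ : IsEnvelopeMap J)
    {V : Submodule 𝕜 E} (hV : V.ClosedComplemented) :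
    (envelopeSubmodule J V).ClosedComplemented := by
  obtain ⟨P, hP⟩ := hV
  obtain ⟨S, hS⟩ := hJ.exists_extend (envelopeRestrict J V ∘L P)
  refine ⟨S, fun y => Subtype.ext ?_⟩
  have hle : envelopeSubmodule J V ≤
      LinearMap.eqLocus ((envelopeSubmodule J V).subtypeL ∘L S).toLinearMap LinearMap.id := by
    refine Submodule.topologicalClosure_minimal _ ?_ (isClosed_eq
      ((envelopeSubmodule J V).subtypeL ∘L S).continuous continuous_id)
    rintro _ ⟨x, hx, rfl⟩
    have := congrArg Subtype.val (hS x)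
    simpa [hP ⟨x, hx⟩, envelopeRestrict] using this
  exact hle y.2

theorem IsEnvelopeMap.nonempty_envelopeSubmodule_prodMap_id_equiv [CompleteSpace B]
    [CompleteSpace B'] (hJ : IsEnvelopeMap J) {V : Submodule 𝕜 (E × B')} {V₁ : Submodule 𝕜 E}
    {V₂ : Submodule 𝕜 B'} (hV : V.ClosedComplemented) (hV₁ : V₁.ClosedComplemented)
    (hV₂ : V₂.ClosedComplemented) (e : V ≃L[𝕜] (V₁ × V₂)) :
    Nonempty (envelopeSubmodule (J.prodMap (.id 𝕜 B')) V ≃L[𝕜] (envelopeSubmodule J V₁ × V₂)) :=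
  have := hV₂.isClosed.completeSpace_coe
  ((hJ.prodMap .id).restrict hV).nonempty_equiv ((hJ.restrict hV₁).prodMap .id) e

theorem IsEnvelopeMap.finiteDimensional_of_envelopeSubmodule [SeparatingDual 𝕜 E]
    (hJ : IsEnvelopeMap J) (V : Submodule 𝕜 E) [FiniteDimensional 𝕜 (envelopeSubmodule J V)] :
    FiniteDimensional 𝕜 V :=
  .of_injective (envelopeRestrict J V).toLinearMap fun _ _ h =>
    Subtype.ext (hJ.injective (congrArg Subtype.val h))

theorem closedSpan_comp [IsTopologicalAddGroup E] [ContinuousSMul 𝕜 E] {ι : Type*} (J : E →L[𝕜] B)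
    (b : ι → E) (A : Set ι) : closedSpan 𝕜 (J ∘ b) A = envelopeSubmodule J (closedSpan 𝕜 b A) := by
  have hcl := Submodule.isClosed_topologicalClosure (R := 𝕜) (M := B)
  refine le_antisymm (closedSpan_le (hcl _) fun n hn => ?_) ?_
  · exact Submodule.le_topologicalClosure _ (Submodule.mem_map_of_mem (mem_closedSpan hn))
  · refine Submodule.topologicalClosure_minimal _ (Submodule.map_le_iff_le_comap.2 ?_) (hcl _)
    exact closedSpan_le ((hcl _).preimage J.continuous) fun n hn => mem_closedSpan hn

theorem tendsto_of_denseRange_of_norm_le {α β : Type*} {l : Filter α} {S : α → B →L[𝕜] B}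
    {J : β → B} (hJ : DenseRange J) {C : ℝ} (hS : ∀ i x, ‖S i (J x)‖ ≤ C * ‖J x‖)
    (hlim : ∀ x, Tendsto (fun i => S i (J x)) l (𝓝 (J x))) (z : B) :
    Tendsto (fun i => S i z) l (𝓝 z) := by
  have hS' : ∀ i z, ‖S i z‖ ≤ C * ‖z‖ := fun i z =>
    hJ.induction_on z (isClosed_le (by fun_prop) (by fun_prop)) (hS i)
  have : (comap J (𝓝 z)).NeBot := comap_neBot fun t ht => hJ.mem_nhds ht
  have hJz : Tendsto J (comap J (𝓝 z)) (𝓝 z) := tendsto_comap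
  have hu : Tendsto (fun x => C * ‖z - J x‖) (comap J (𝓝 z)) (𝓝 0) := by
    simpa only [sub_self, norm_zero, mul_zero] using
      (hJz.const_sub z).norm.const_mul C
  have hunif : TendstoUniformly (fun x i => S i (J x)) (fun i => S i z) (comap J (𝓝 z)) := by
    refine Metric.tendstoUniformly_iff.2 fun ε hε => ?_
    filter_upwards [hu.eventually_lt_const hε] with x hx i
    rw [dist_eq_norm, ← map_sub]
    exact (hS' i _).trans_lt hx
  exact hunif.tendsto_of_eventually_tendsto (.of_forall hlim) hJz

theorem IsUnconditionalBasis.comp_envelopeMap [IsTopologicalAddGroup E] [ContinuousSMul 𝕜 E]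
    [QuasiBanachSpace 𝕜 E] [CompleteSpace B] {ι : Type*} {b : ι → E}
    (hb : IsUnconditionalBasis 𝕜 b) (hJ : IsEnvelopeMap J) : IsUnconditionalBasis 𝕜 (J ∘ b) := by
  classical
  have := hb.countable
  choose φ hφ using fun n => hJ.exists_extend (hb.coordL n)
  have hφb : ∀ m n, φ m (J (b n)) = if m = n then 1 else 0 := fun m n =>
    (hφ m (b n)).trans (hb.coord_apply m n)
  refine .of_biorthogonal (φ := φ) (fun m n hmn => (hφb m n).trans (if_neg hmn))
    (fun n => (hφb n n).trans (if_pos rfl)) fun z => ?_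
  let S : Finset ι → B →L[𝕜] B := fun s => ∑ n ∈ s, (φ n).smulRight (J (b n))
  have hS : ∀ s z, S s z = ∑ n ∈ s, φ n z • J (b n) := fun s z => by simp [S]
  have hSJ : ∀ s x, S s (J x) = J (hb.partialSum s x) := fun s x => by
    simp only [hS, hφ, hb.partialSum_apply, map_sum, map_smul]
    rfl
  obtain ⟨p, hp, hpS⟩ := hb.exists_seminorm_partialSum_le
    (q := (normSeminorm 𝕜 B).comp J.toLinearMap) J.continuous.norm
  obtain ⟨C, hC⟩ := hJ.exists_seminorm_le p hp
  have hlim := tendsto_of_denseRange_of_norm_le (S := S) hJ.denseRange (C := C)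
    (fun s x => hSJ s x ▸ (hpS s x).trans (hC x))
    (fun x => by
      simpa only [hSJ, Function.comp_def] using
        (J.continuous.tendsto x).comp (hb.tendsto_partialSum x)) z
  simpa only [HasSum, SummationFilter.unconditional_filter, hS, Function.comp_apply] using hlim

end EnvelopeMap

section EnvelopeMapL

open QuasiBanachSpace NNReal

variable (𝕜 : Type*) [RCLike 𝕜]
  (E : Type*) [AddCommGroup E] [Module 𝕜 E] [TopologicalSpace E] [IsTopologicalAddGroup E]
  [ContinuousSMul 𝕜 E] [QuasiBanachSpace 𝕜 E]

/-- The envelope map as a continuous linear map. -/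
noncomputable def envelopeMapL : E →L[𝕜] BanachEnvelope 𝕜 E :=
  ⟨envelopeMap 𝕜 E, continuous_of_qnorm_le (C := 1) fun x =>
    (norm_envelopeMap_le x).trans_eq (one_mul _).symm⟩

theorem isEnvelopeMap_envelopeMapL : IsEnvelopeMap (envelopeMapL 𝕜 E) where
  denseRange := UniformSpace.Completion.denseRange_coe (α := PreEnvelope 𝕜 E)
  exists_seminorm_le p hp := by
    obtain ⟨C, hC₀, hC⟩ := exists_seminorm_le_mul_qnorm hp
    lift C to ℝ≥0 using hC₀.le
    refine ⟨C, fun x => ?_⟩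
    have hmem : C⁻¹ • p ∈ {p : Seminorm 𝕜 E | ∀ x, p x ≤ qnorm 𝕜 x} := fun y =>
      (inv_mul_le_iff₀ hC₀).2 (hC y)
    have hle : (C : ℝ)⁻¹ * p x ≤ envelopeSeminorm 𝕜 E x := le_csSup envelopeSeminorm_bddAbove hmem x
    exact ((inv_mul_le_iff₀ hC₀).1 hle).trans_eq (congrArg _ (norm_envelopeMap x).symm)

end EnvelopeMapL

/-! ### Isomorphisms of direct sums -/

section DirectSums

variable {𝕜 : Type*} [RCLike 𝕜]
  {E : Type*} [AddCommGroup E] [Module 𝕜 E] [TopologicalSpace E]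
  {F : Type*} [AddCommGroup F] [Module 𝕜 F] [TopologicalSpace F]
  {G : Type*} [AddCommGroup G] [Module 𝕜 G] [TopologicalSpace G]
  {H : Type*} [AddCommGroup H] [Module 𝕜 H] [TopologicalSpace H]

theorem separatingDual_of_injective [SeparatingDual 𝕜 F] (T : E →L[𝕜] F)
    (hT : Function.Injective T) : SeparatingDual 𝕜 E where
  exists_ne_zero' _ hx :=
    let ⟨f, hf⟩ := SeparatingDual.exists_ne_zero (R := 𝕜) ((map_ne_zero_iff T hT).2 hx)
    ⟨f ∘L T, hf⟩

theorem nonempty_equiv_of_prod_equiv_of_triangular (φ : (E × G) ≃L[𝕜] (F × H))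
    (hφ : ∀ z, (φ (0, z)).1 = 0) (hφ' : ∀ z, (φ.symm (0, z)).1 = 0) :
    Nonempty (E ≃L[𝕜] F) ∧ Nonempty (G ≃L[𝕜] H) := by
  refine ⟨⟨.equivOfInverse (.fst 𝕜 F H ∘L φ ∘L .inl 𝕜 E G) (.fst 𝕜 E G ∘L φ.symm ∘L .inl 𝕜 F H)
      (fun x => ?_) fun y => ?_⟩,
    ⟨.equivOfInverse (.snd 𝕜 F H ∘L φ ∘L .inr 𝕜 E G) (.snd 𝕜 E G ∘L φ.symm ∘L .inr 𝕜 F H)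
      (fun x => ?_) fun y => ?_⟩⟩
  · have h : ((φ (x, 0)).1, (0 : H)) = φ (x, 0) - (0, (φ (x, 0)).2) := by ext <;> simp
    simp [h, hφ']
  · have h : ((φ.symm (y, 0)).1, (0 : G)) = φ.symm (y, 0) - (0, (φ.symm (y, 0)).2) := by
      ext <;> simp
    simp [h, hφ]
  · have h : ((0 : F), (φ (0, x)).2) = φ (0, x) := Prod.ext (hφ x).symm rfl
    simp [h]
  · have h : ((0 : E), (φ.symm (0, y)).2) = φ.symm (0, y) := Prod.ext (hφ' y).symm rfl
    simp [h]

theorem nonempty_equiv_of_equiv_prod_self [SeparatingDual 𝕜 G] [IsTopologicalAddGroup G]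
    [ContinuousSMul 𝕜 G] (e : G ≃L[𝕜] (E × 𝕜)) (e' : G ≃L[𝕜] (F × 𝕜)) :
    Nonempty (E ≃L[𝕜] F) := by
  -- An automorphism of `G` moves one one-dimensional summand onto the other.
  obtain ⟨A, hA⟩ := SeparatingDual.exists_continuousLinearEquiv_apply_eq (R := 𝕜)
    (x := e.symm (0, 1)) (y := e'.symm (0, 1)) (by simp) (by simp)
  let φ : (E × 𝕜) ≃L[𝕜] (F × 𝕜) := e.symm.trans (A.trans e')
  have hφ : ∀ c : 𝕜, φ (0, c) = (0, c) := fun c => by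
    have h := congrArg (c • e' ·) hA
    simpa [← map_smul, φ] using h
  exact (nonempty_equiv_of_prod_equiv_of_triangular φ (fun c => by rw [hφ])
    fun c => by rw [φ.symm_apply_eq.2 (hφ c).symm]).1

end DirectSums

namespace IsUnconditionalBasis

open QuasiBanachSpace Module

variable {𝕜 : Type*} [RCLike 𝕜]
  {E : Type*} [AddCommGroup E] [Module 𝕜 E] [TopologicalSpace E] [IsTopologicalAddGroup E]
  [ContinuousSMul 𝕜 E] [QuasiBanachSpace 𝕜 E] {ι : Type*} {b : ι → E}
  {Z : Type*} [AddCommGroup Z] [Module 𝕜 Z] [TopologicalSpace Z]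

theorem nonempty_closedSpan_singleton_equiv (hb : IsUnconditionalBasis 𝕜 b) (n : ι) :
    Nonempty (closedSpan 𝕜 b {n} ≃L[𝕜] 𝕜) := by
  have := t2Space 𝕜 E
  have hspan : closedSpan 𝕜 b {n} = 𝕜 ∙ b n := by
    rw [closedSpan, Set.image_singleton]
    exact (Submodule.closed_of_finiteDimensional _).submodule_topologicalClosure_eq
  exact ⟨(ContinuousLinearEquiv.ofEq _ _ hspan).trans
    (.ofFinrankEq (by rw [finrank_span_singleton (hb.ne_zero n), finrank_self]))⟩

theorem nonempty_closedSpan_insert_equiv (hb : IsUnconditionalBasis 𝕜 b) {A : Set ι} {n : ι}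
    (hn : n ∉ A) : Nonempty (closedSpan 𝕜 b (insert n A) ≃L[𝕜] (closedSpan 𝕜 b A × 𝕜)) := by
  obtain ⟨e⟩ := hb.nonempty_closedSpan_union_equiv (Set.disjoint_singleton_right.2 hn)
  obtain ⟨e₁⟩ := hb.nonempty_closedSpan_singleton_equiv n
  rw [Set.union_singleton] at e
  exact ⟨e.trans (.prodCongr (.refl 𝕜 _) e₁)⟩

theorem exists_sdiff_singleton_equiv (hb : IsUnconditionalBasis 𝕜 b) {A : Set ι}
    (e : closedSpan 𝕜 b A ≃L[𝕜] (Z × 𝕜)) :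
    ∃ n ∈ A, Nonempty (closedSpan 𝕜 b (A \ {n}) ≃L[𝕜] Z) ∧
      Nonempty (closedSpan 𝕜 b (A \ {n})ᶜ ≃L[𝕜] (closedSpan 𝕜 b Aᶜ × 𝕜)) := by
  have := t2Space 𝕜 E
  have := hb.separatingDual
  have : SeparatingDual 𝕜 (closedSpan 𝕜 b A) :=
    separatingDual_of_injective (Submodule.subtypeL _) Subtype.val_injective
  obtain ⟨n, hn⟩ : A.Nonempty := by
    rw [Set.nonempty_iff_ne_empty]
    rintro rfl
    have hbot : closedSpan 𝕜 b ∅ ≤ ⊥ := closedSpan_le isClosed_singleton fun n hn => hn.elim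
    have h : e.symm (0, 1) = 0 := Subtype.ext ((Submodule.mem_bot 𝕜).1 (hbot (e.symm (0, 1)).2))
    simp at h
  obtain ⟨e₁⟩ := hb.nonempty_closedSpan_insert_equiv (A := A \ {n}) (n := n) (by simp)
  obtain ⟨e₂⟩ := hb.nonempty_closedSpan_insert_equiv (A := Aᶜ) (n := n) (by simpa using hn)
  rw [Set.insert_sdiff_singleton, Set.insert_eq_of_mem hn] at e₁
  have hcompl : insert n Aᶜ = (A \ {n})ᶜ := by
    rw [Set.sdiff_eq, Set.compl_inter, compl_compl, Set.union_singleton]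
  exact ⟨n, hn, nonempty_equiv_of_equiv_prod_self e₁ e, hcompl ▸ ⟨e₂⟩⟩

theorem exists_equiv_and_compl_equiv_prod (hb : IsUnconditionalBasis 𝕜 b) {d : ℕ} {A : Set ι}
    (e : closedSpan 𝕜 b A ≃L[𝕜] (Z × (Fin d → 𝕜))) :
    ∃ B : Set ι, Nonempty (closedSpan 𝕜 b B ≃L[𝕜] Z) ∧
      Nonempty (closedSpan 𝕜 b Bᶜ ≃L[𝕜] (closedSpan 𝕜 b Aᶜ × (Fin d → 𝕜))) := by
  induction d generalizing A with
  | zero =>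
    exact ⟨A, ⟨e.trans (.prodUnique 𝕜 Z (Fin 0 → 𝕜))⟩, ⟨(ContinuousLinearEquiv.prodUnique ..).symm⟩⟩
  | succ d ih =>
    let e_succ : (Fin (d + 1) → 𝕜) ≃L[𝕜] ((Fin d → 𝕜) × 𝕜) := .ofFinrankEq (by simp)
    obtain ⟨n, -, ⟨e₁⟩, ⟨e₂⟩⟩ := hb.exists_sdiff_singleton_equiv
      ((e.trans (.prodCongr (.refl 𝕜 Z) e_succ)).trans (.symm (.prodAssoc 𝕜 _ _ _)))
    obtain ⟨B, hB, ⟨e₃⟩⟩ := ih e₁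
    exact ⟨B, hB, ⟨((e₃.trans (e₂.prodCongr (.refl 𝕜 _))).trans (.prodAssoc 𝕜 _ _ _)).trans
      (.prodCongr (.refl 𝕜 _) ((ContinuousLinearEquiv.prodComm ..).trans e_succ.symm))⟩⟩

end IsUnconditionalBasis

section FiniteDimensionalCorrection

open QuasiBanachSpace Module

variable {𝕜 : Type*} [RCLike 𝕜]
  {E : Type*} [AddCommGroup E] [Module 𝕜 E] [TopologicalSpace E] [IsTopologicalAddGroup E]
  [ContinuousSMul 𝕜 E] [QuasiBanachSpace 𝕜 E] {ι : Type*} {b : ι → E} {A : Set ι}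
  {X : Type*} [AddCommGroup X] [Module 𝕜 X] [TopologicalSpace X]
  {U : Type*} [AddCommGroup U] [Module 𝕜 U] [TopologicalSpace U]
  {M : Type*} [AddCommGroup M] [Module 𝕜 M] [TopologicalSpace M]
  {N : Type*} [AddCommGroup N] [Module 𝕜 N] [TopologicalSpace N]
  {F : Type*} [AddCommGroup F] [Module 𝕜 F] [TopologicalSpace F] [IsTopologicalAddGroup F]
  [ContinuousSMul 𝕜 F] [T2Space F] [FiniteDimensional 𝕜 F]
  {G : Type*} [AddCommGroup G] [Module 𝕜 G] [TopologicalSpace G] [IsTopologicalAddGroup G]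
  [ContinuousSMul 𝕜 G] [T2Space G] [FiniteDimensional 𝕜 G]

theorem IsUnconditionalBasis.exists_splitting_of_finrank_le (hb : IsUnconditionalBasis 𝕜 b)
    (eX : X ≃L[𝕜] (M × G)) (eU : U ≃L[𝕜] (N × F)) (eA : closedSpan 𝕜 b A ≃L[𝕜] (M × F))
    (eA' : closedSpan 𝕜 b Aᶜ ≃L[𝕜] (N × G)) (hFG : finrank 𝕜 F ≤ finrank 𝕜 G) :
    ∃ B : Set ι, Nonempty (closedSpan 𝕜 b B ≃L[𝕜] X) ∧ Nonempty (closedSpan 𝕜 b Bᶜ ≃L[𝕜] U) := by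
  obtain ⟨d, hd⟩ := Nat.exists_eq_add_of_le hFG
  let e : G ≃L[𝕜] (F × (Fin d → 𝕜)) := .ofFinrankEq (by simp [hd])
  let eAU : closedSpan 𝕜 b Aᶜ ≃L[𝕜] (U × (Fin d → 𝕜)) :=
    (eA'.trans (.prodCongr (.refl 𝕜 N) e)).trans
      ((ContinuousLinearEquiv.prodAssoc ..).symm.trans (eU.symm.prodCongr (.refl 𝕜 _)))
  obtain ⟨B, hB, ⟨e'⟩⟩ := hb.exists_equiv_and_compl_equiv_prod eAU
  rw [compl_compl] at e'
  refine ⟨Bᶜ, ⟨(e'.trans (eA.prodCongr (.refl 𝕜 _))).trans ?_⟩, by rwa [compl_compl]⟩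
  exact (ContinuousLinearEquiv.prodAssoc ..).trans
    ((ContinuousLinearEquiv.prodCongr (.refl 𝕜 M) e.symm).trans eX.symm)

theorem IsUnconditionalBasis.exists_splitting_of_finiteDimensional
    (hb : IsUnconditionalBasis 𝕜 b) (eX : X ≃L[𝕜] (M × G)) (eU : U ≃L[𝕜] (N × F))
    (eA : closedSpan 𝕜 b A ≃L[𝕜] (M × F)) (eA' : closedSpan 𝕜 b Aᶜ ≃L[𝕜] (N × G)) :
    ∃ B : Set ι, Nonempty (closedSpan 𝕜 b B ≃L[𝕜] X) ∧ Nonempty (closedSpan 𝕜 b Bᶜ ≃L[𝕜] U) := by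
  rcases le_total (finrank 𝕜 F) (finrank 𝕜 G) with h | h
  · exact hb.exists_splitting_of_finrank_le eX eU eA eA' h
  · rw [← compl_compl A] at eA
    obtain ⟨B, hBU, hBX⟩ := hb.exists_splitting_of_finrank_le eU eX eA' eA h
    exact ⟨Bᶜ, hBX, by rwa [compl_compl]⟩

end FiniteDimensionalCorrection

/-! ### Splitting and incomparable pairs -/

section Pairs

variable {𝕜 : Type*} [RCLike 𝕜]
  {X : Type*} [AddCommGroup X] [Module 𝕜 X] [TopologicalSpace X]
  {Y : Type*} [AddCommGroup Y] [Module 𝕜 Y] [TopologicalSpace Y]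

theorem SplittingForComplementedSubspaces.exists_isTopCompl
    [IsTopologicalAddGroup X] [IsTopologicalAddGroup Y]
    (h : SplittingForComplementedSubspaces 𝕜 X Y) {V W : Submodule 𝕜 (X × Y)}
    (hVW : V.IsTopCompl W) :
    ∃ (V₁ W₁ : Submodule 𝕜 X) (V₂ W₂ : Submodule 𝕜 Y), V₁.IsTopCompl W₁ ∧ V₂.IsTopCompl W₂ ∧
      Nonempty (V ≃L[𝕜] (V₁ × V₂)) ∧ Nonempty (W ≃L[𝕜] (W₁ × W₂)) := by
  obtain ⟨V₁, V₂, T, hV₁, hV₂, hT⟩ := h V hVW.closedComplemented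
  obtain ⟨W₁, h₁⟩ := hV₁.exists_isTopCompl
  obtain ⟨W₂, h₂⟩ := hV₂.exists_isTopCompl
  let e := Submodule.prodEquivOfIsTopCompl W V hVW.symm
  let e₁₂ : ((W₁ × W₂) × (V₁ × V₂)) ≃L[𝕜] X × Y :=
    (ContinuousLinearEquiv.prodProdProdComm ..).trans
      ((Submodule.prodEquivOfIsTopCompl W₁ V₁ h₁.symm).prodCongr
        (Submodule.prodEquivOfIsTopCompl W₂ V₂ h₂.symm))
  have he : ∀ v, e (0, v) = v := fun v => zero_add _
  have he₁₂ : ∀ v, e₁₂ (0, v) = (↑v.1, ↑v.2) := fun v => Prod.ext (zero_add _) (zero_add _)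
  refine ⟨V₁, W₁, V₂, W₂, h₁, h₂, ?_⟩
  refine (nonempty_equiv_of_prod_equiv_of_triangular (e.trans (T.trans e₁₂.symm)) ?_ ?_).symm
  · intro v
    have hv : T v ∈ V₁.prod V₂ := hT ▸ Submodule.mem_map_of_mem v.2
    have : e₁₂ (0, (⟨_, hv.1⟩, ⟨_, hv.2⟩)) = T (e (0, v)) := by rw [he₁₂, he]
    simp [← this]
  · intro v
    obtain ⟨x, hx, hxv⟩ : ((v.1, v.2) : X × Y) ∈ V.map (T : (X × Y) →ₗ[𝕜] X × Y) :=
      hT ▸ ⟨v.1.2, v.2.2⟩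
    have : T (e (0, ⟨x, hx⟩)) = e₁₂ (0, v) := by rw [he₁₂, he]; exact hxv
    simp [← this]

theorem ComplementablyIncomparable.symm (h : ComplementablyIncomparable 𝕜 X Y) :
    ComplementablyIncomparable 𝕜 Y X := fun V W hV hW ⟨e⟩ =>
  have := h W V hW hV ⟨e.symm⟩
  .of_injective e.toLinearMap e.injective

theorem ComplementablyIncomparable.finiteDimensional_of_equiv_prod
    (h : ComplementablyIncomparable 𝕜 X Y) {W : Submodule 𝕜 Y} (hW : W.ClosedComplemented)
    {M : Type*} [AddCommGroup M] [Module 𝕜 M] [TopologicalSpace M] (e : X ≃L[𝕜] (M × W)) :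
    FiniteDimensional 𝕜 W := by
  let i : W →L[𝕜] X := e.symm ∘L .inr 𝕜 M W
  let r : X →L[𝕜] W := .snd 𝕜 M W ∘L e
  have hri : Function.LeftInverse r i := fun w => by simp [i, r]
  let e' : W ≃L[𝕜] i.range := .equivOfInverse
    (i.codRestrict _ (LinearMap.mem_range_self _)) (r ∘L i.range.subtypeL) hri <| by
      rintro ⟨_, w, rfl⟩
      exact Subtype.ext (congrArg i (hri w))
  have := h _ W (i.closedComplemented_range_of_leftInverse r hri) hW ⟨e'.symm⟩
  exact .of_injective e'.toLinearMap e'.injective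

end Pairs

theorem lemma2p9_general {𝕜 : Type*} [RCLike 𝕜]
    {X : Type u} [AddCommGroup X] [Module 𝕜 X] [TopologicalSpace X] [IsTopologicalAddGroup X]
    [ContinuousSMul 𝕜 X] [QuasiBanachSpace 𝕜 X]
    {U : Type v} [NormedAddCommGroup U] [NormedSpace 𝕜 U] [CompleteSpace U]
    (h_compl : SplittingForComplementedSubspaces 𝕜 X U)
    (h_basis : SplittingForUnconditionalBases 𝕜 (BanachEnvelope 𝕜 X) U)
    (h_incomp : ComplementablyIncomparable 𝕜 (BanachEnvelope 𝕜 X) U) :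
    SplittingForUnconditionalBases 𝕜 X U := by
  intro ι b hb
  have := QuasiBanachSpace.t2Space 𝕜 X
  have := hb.separatingDual
  have : SeparatingDual 𝕜 X := separatingDual_of_injective (.inl 𝕜 X U) LinearMap.inl_injective
  have hJ := isEnvelopeMap_envelopeMapL 𝕜 X
  obtain ⟨A, ⟨eX⟩, ⟨eU⟩⟩ := h_basis ι _ (hb.comp_envelopeMap (hJ.prodMap .id))
  rw [closedSpan_comp] at eX eU
  have hA := hb.isTopCompl_closedSpan_compl A
  obtain ⟨V₁, W₁, V₂, W₂, h₁, h₂, ⟨eA⟩, ⟨eA'⟩⟩ := h_compl.exists_isTopCompl hA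
  obtain ⟨eV⟩ := hJ.nonempty_envelopeSubmodule_prodMap_id_equiv
    hA.closedComplemented h₁.closedComplemented h₂.closedComplemented eA
  obtain ⟨eW⟩ := hJ.nonempty_envelopeSubmodule_prodMap_id_equiv
    hA.symm.closedComplemented h₁.symm.closedComplemented h₂.symm.closedComplemented eA'
  have : FiniteDimensional 𝕜 V₂ :=
    h_incomp.finiteDimensional_of_equiv_prod h₂.closedComplemented (eX.symm.trans eV)
  have : FiniteDimensional 𝕜 (envelopeSubmodule (envelopeMapL 𝕜 X) W₁) :=
    h_incomp.symm.finiteDimensional_of_equiv_prod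
      (hJ.closedComplemented h₁.symm.closedComplemented)
      (eU.symm.trans (eW.trans (.prodComm 𝕜 _ _)))
  have : FiniteDimensional 𝕜 W₁ := hJ.finiteDimensional_of_envelopeSubmodule W₁
  exact hb.exists_splitting_of_finiteDimensional (Submodule.prodEquivOfIsTopCompl V₁ W₁ h₁).symm
    (Submodule.prodEquivOfIsTopCompl W₂ V₂ h₂.symm).symm eA (eA'.trans (.prodComm 𝕜 _ _))

theorem lemma2p9 {𝕜 : Type*} [RCLike 𝕜]
    {X : Type u} [AddCommGroup X] [Module 𝕜 X] [TopologicalSpace X] [IsTopologicalAddGroup X]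
    [ContinuousSMul 𝕜 X] [QuasiBanachSpace 𝕜 X]
    {U : Type v} [NormedAddCommGroup U] [NormedSpace 𝕜 U] [CompleteSpace U]
    (h_compl : SplittingForComplementedSubspaces 𝕜 X U)
    (h_basis : SplittingForUnconditionalBases 𝕜 (BanachEnvelope 𝕜 X) U)
    (h_incomp : ComplementablyIncomparable 𝕜 (BanachEnvelope 𝕜 X) U)
    (h_env : ¬ IsProperEnvelope.{v, max u v} 𝕜 U ∨
      (IsNatural 𝕜 X ∧ ¬ IsProperEnvelopeOfNatural.{v, max u v} 𝕜 U)) :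
    SplittingForUnconditionalBases 𝕜 X U :=
  lemma2p9_general h_compl h_basis h_incomp
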